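/- Let $d\ge 2$. Let $\mathrm{C}$ be the $d$-dimensional cross-polytope with vertices $\pm e_1,\dots,\pm e_d$, and let $Q=\frac1{2d}[-1,1]^d$ be a small copy of its polar dual in its interior. The antiprism subdivision $\mathfrak A(\mathrm{C})$ is the polytopal complex whose cells are the convex hulls of $\sigma\cup\sigma^*$ and their faces, where $\sigma$ runs over the proper faces of $\mathrm{C}$ (including $\emptyset$, with $\emptyset^*=Q$) and $\sigma^*$ is the face of $Q$ dual to $\sigma$. A triangulation is regular if it is the lower convex hull of a lifting of its points by some height function. A free face of a simplicial complex is a nonempty face that is properly contained in exactly one other face. Then there is a regular triangulation $T$ of $\mathfrak A(\mathrm{C})$, without new vertices, with the following property. Stack every boundary facet of $\mathrm{C}$ other than $\mathrm{conv}(e_1,\dots,e_d)$, that is, subdivide it by one new vertex, which is joined to the boundary of the facet and to the opposite vertex of the simplex of $T$ containing the facet. Then identify all these stacked facets with each other by identifying $e_i$ with $-e_i$ for every $i$ and all the new vertices with each other. The resulting quotient $\Sigma_d$ (in which faces are identified only if they lie in stacked boundary facets) is a simplicial complex of dimension $d$ with exactly $2^d+d+1$ vertices. It is shellable (in particular pure)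 and collapsible, and it has exactly one free face. -/

import Mathlib

/-! ### Finite simplicial complexes: facets, dimension, collapses, shellings

A simplicial complex is Mathlib's `PreAbstractSimplicialComplex V`: a downward closed family of
nonempty finite subsets of `V`; its vertices are the `v : V` for which `{v}` is a face. -/

namespace PreAbstractSimplicialComplex

/-- The set of vertices that occur in `K`. -/
def vertexSet {V : Type*} (K : PreAbstractSimplicialComplex V) : Set V :=
  {v | {v} ∈ K.faces}

/-- A facet is an inclusion-maximal face. -/
def IsFacet {V : Type*} (K : PreAbstractSimplicialComplex V) (s : Finset V) : Prop :=
  Maximal (fun t => t ∈ K.faces) s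

/-- `K` is `d`-dimensional: the largest faces have exactly `d + 1` vertices. -/
def HasDimension {V : Type*} (K : PreAbstractSimplicialComplex V) (d : ℕ) : Prop :=
  (∀ s ∈ K.faces, s.card ≤ d + 1) ∧ ∃ s ∈ K.faces, s.card = d + 1

/-- A free face is a (nonempty) face that is properly contained in exactly one other face. -/
def IsFreeFace {V : Type*} (K : PreAbstractSimplicialComplex V) (s : Finset V) : Prop :=
  s ∈ K.faces ∧ ∃! t, t ∈ K.faces ∧ s ⊂ t

/-- An elementary collapse deletes a free face `s` together with the unique face `t` that
properly contains it. (Then automatically `t` has one vertex more than `s`.) -/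
def ElementaryCollapse {V : Type*} (K L : PreAbstractSimplicialComplex V) : Prop :=
  ∃ s t : Finset V, s ∈ K.faces ∧ t ∈ K.faces ∧ s ⊂ t ∧
    (∀ u ∈ K.faces, s ⊂ u → u = t) ∧ L.faces = K.faces \ {s, t}

/-- `K` is collapsible: finitely many elementary collapses reduce it to a single vertex. -/
def IsCollapsible {V : Type*} (K : PreAbstractSimplicialComplex V) : Prop :=
  ∃ (L : PreAbstractSimplicialComplex V) (v : V),
    L.faces = {{v}} ∧ Relation.ReflTransGen ElementaryCollapse K L

/-- `K` is pure: all its facets have the same dimension. -/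
def IsPure {V : Type*} (K : PreAbstractSimplicialComplex V) : Prop :=
  ∃ n : ℕ, ∀ s, K.IsFacet s → s.card = n

/-- `K` is shellable: it is pure and its facets can be listed, without repetition, as
`F 0, …, F (m - 1)` so that, for every `i > 0`, the intersection of `F i` with the union of the
earlier facets is pure of codimension one in `F i`. That is, every intersection `F j ∩ F i` with
an earlier facet lies in a codimension-one face of `F i` which is itself of the form `F k ∩ F i`
with `F k` an earlier facet. -/
def IsShellable {V : Type*} [DecidableEq V] (K : PreAbstractSimplicialComplex V) : Prop :=
  K.IsPure ∧
  ∃ (m : ℕ) (F : Fin m → Finset V), Function.Injective F ∧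
    Set.range F = {s | K.IsFacet s} ∧
    ∀ i j : Fin m, j < i →
      ∃ k : Fin m, k < i ∧ F j ∩ F i ⊆ F k ∩ F i ∧ (F k ∩ F i).card + 1 = (F i).card

/-- Stacking (simultaneous stellar subdivision) of the faces `F a`, `a : ι`, of `K`. For every `a`
there is a new vertex `Sum.inr a`. All faces that contain some `F a` are deleted, and in place of
the faces containing `F a` one takes the faces `{a} ∪ G`, where `G` contains no stacked face and
`G ∪ F a` is a face of `K`. (This is used for families such that no face of `K` contains two of
the sets `F a`; then it agrees with stacking the `F a` one after the other.) -/
def stack {V ι : Type*} [DecidableEq V] [DecidableEq ι]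
    (K : PreAbstractSimplicialComplex V) (F : ι → Finset V) :
    PreAbstractSimplicialComplex (V ⊕ ι) where
  faces := {S |
    (∃ G : Finset V, G ∈ K.faces ∧ (∀ b, ¬ F b ⊆ G) ∧ S = G.image Sum.inl) ∨
    (∃ (a : ι) (G : Finset V), G ∪ F a ∈ K.faces ∧ (∀ b, ¬ F b ⊆ G) ∧
      S = insert (Sum.inr a) (G.image Sum.inl))}
  isRelLowerSet_faces := by
    rintro S (⟨G, hG, hF, rfl⟩ | ⟨a, G, hG, hF, rfl⟩)
    · refine ⟨(K.isRelLowerSet_faces hG).1.image _, ?_⟩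
      intro S' hS' hne
      obtain ⟨G', hG', rfl⟩ := Finset.subset_image_iff.mp hS'
      have hG'' : G' ⊆ G := by exact_mod_cast hG'
      exact Or.inl ⟨G', (K.isRelLowerSet_faces hG).2 hG'' (Finset.image_nonempty.mp hne),
        fun b hb => hF b (hb.trans hG''), rfl⟩
    · refine ⟨Finset.insert_nonempty _ _, ?_⟩
      intro S' hS' hne
      have hsub : S'.erase (Sum.inr a) ⊆ G.image Sum.inl := Finset.subset_insert_iff.mp hS'
      obtain ⟨G', hG', hE⟩ := Finset.subset_image_iff.mp hsub
      have hG'' : G' ⊆ G := by exact_mod_cast hG'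
      have hF' : ∀ b, ¬ F b ⊆ G' := fun b hb => hF b (hb.trans hG'')
      by_cases ha : Sum.inr a ∈ S'
      · refine Or.inr ⟨a, G', (K.isRelLowerSet_faces hG).2
          (Finset.union_subset_union_left hG'') ?_, hF', ?_⟩
        · obtain ⟨x, hx, -⟩ := Finset.not_subset.mp (hF a)
          exact ⟨x, Finset.mem_union_right _ hx⟩
        · rw [hE, Finset.insert_erase ha]
      · rw [Finset.erase_eq_of_notMem ha] at hE
        subst hE
        exact Or.inl ⟨G', (K.isRelLowerSet_faces hG).2 (hG''.trans Finset.subset_union_left)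
          (Finset.image_nonempty.mp hne), hF', rfl⟩

/-- `T` is a regular triangulation of the finite point configuration `p : V → E`: there are
heights `ω` such that the faces of `T` are exactly the lower faces of the convex hull of the lifted
points `(p v, ω v)` (that is, the nonempty sets of points at which some affine function `f` with
`f ≤ ω` on the configuration touches `ω`), and all these faces are simplices. -/
def IsRegularTriangulation {V E : Type*} [Finite V] [AddCommGroup E] [Module ℝ E]
    (T : PreAbstractSimplicialComplex V) (p : V → E) : Prop :=
  (∃ ω : V → ℝ, ∀ S : Finset V, S ∈ T.faces ↔
    S.Nonempty ∧ ∃ f : E →ᵃ[ℝ] ℝ, (∀ v, f (p v) ≤ ω v) ∧ ∀ v, f (p v) = ω v ↔ v ∈ S) ∧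
  ∀ S ∈ T.faces, AffineIndependent ℝ (fun v : S => p v)

end PreAbstractSimplicialComplex

/-! ### The antiprism subdivision of the cross-polytope -/

namespace Antiprism

/-- The sign of a Boolean: `true` is `+1`, `false` is `-1`. -/
def sgn (b : Bool) : ℝ := if b then 1 else -1

/-- The vertices of the antiprism subdivision of the `d`-dimensional cross-polytope:
`Sum.inl (i, b)` is the vertex `± eᵢ` of the cross-polytope, and `Sum.inr y` is the vertex with
sign vector `y` of the cube in its interior. -/
abbrev Vertex (d : ℕ) : Type := (Fin d × Bool) ⊕ (Fin d → Bool)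

/-- The position of the vertices. The cross-polytope is the convex hull of the `± eᵢ`; its polar
dual is the cube `[-1, 1]ᵈ`, of which the copy scaled by `1 / (2d)` lies in the interior. -/
noncomputable def position (d : ℕ) : Vertex d → (Fin d → ℝ)
  | Sum.inl (i, b) => Pi.single i (sgn b)
  | Sum.inr y => fun i => sgn (y i) / (2 * d)

/-- `σ` is (the vertex set of) a proper, possibly empty, face of the cross-polytope: it does not
contain a pair of antipodal vertices. -/
def IsProperFace {d : ℕ} (σ : Finset (Fin d × Bool)) : Prop :=
  ∀ i : Fin d, ¬ ((i, true) ∈ σ ∧ (i, false) ∈ σ)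

/-- The vertex set of the cell `σ * σ*` of the antiprism subdivision: the vertices of the face `σ`
of the cross-polytope together with the vertices of the dual face `σ*` of the cube, that is of the
face of the cube on which the coordinate `i` has sign `b` for every `(i, b) ∈ σ`. For `σ = ∅` it
is the whole cube. -/
def cell {d : ℕ} (σ : Finset (Fin d × Bool)) : Set (Vertex d) :=
  {v | (∃ a ∈ σ, v = Sum.inl a) ∨ ∃ y : Fin d → Bool, (∀ a ∈ σ, y a.1 = a.2) ∧ v = Sum.inr y}

/-- `T` is a regular triangulation, without new vertices, of the antiprism subdivision of the
`d`-dimensional cross-polytope: a regular triangulation of the configuration of its vertices such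
that each simplex lies in a cell of the antiprism subdivision. -/
def IsRegularAntiprismTriangulation {d : ℕ} (T : PreAbstractSimplicialComplex (Vertex d)) : Prop :=
  T.IsRegularTriangulation (position d) ∧
  ∀ S ∈ T.faces, ∃ σ : Finset (Fin d × Bool), IsProperFace σ ∧ (S : Set (Vertex d)) ⊆ cell σ

/-- The facet of the cross-polytope with sign vector `s`. -/
def crossFacet {d : ℕ} (s : Fin d → Bool) : Finset (Vertex d) :=
  Finset.univ.image fun i => Sum.inl (i, s i)

/-- The facets of the cross-polytope other than the one spanned by `e₁, …, e_d`. -/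
abbrev OtherFacet (d : ℕ) : Type := {s : Fin d → Bool // s ≠ fun _ => true}

/-- The complex obtained from `T` by stacking all the boundary facets of the cross-polytope
other than the one spanned by `e₁, …, e_d`. -/
def stacked {d : ℕ} (T : PreAbstractSimplicialComplex (Vertex d)) :
    PreAbstractSimplicialComplex (Vertex d ⊕ OtherFacet d) :=
  T.stack fun s : OtherFacet d => crossFacet s.1

/-- The vertices of a stacked boundary facet: those of the facet and the stacking vertex. -/
def stackedFacet {d : ℕ} (s : OtherFacet d) : Finset (Vertex d ⊕ OtherFacet d) :=
  insert (Sum.inr s) ((crossFacet s.1).image Sum.inl)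

/-- The identification of the stacked boundary facets with each other, on vertices: both `eᵢ` and
`- eᵢ` become the `i`-th of the `d + 1` labels, all stacking vertices become the last one, and the
vertices of the cube are kept apart. -/
def identify (d : ℕ) : Vertex d ⊕ OtherFacet d → Fin (d + 1) ⊕ (Fin d → Bool)
  | Sum.inl (Sum.inl (i, _)) => Sum.inl i.castSucc
  | Sum.inl (Sum.inr y) => Sum.inr y
  | Sum.inr _ => Sum.inl (Fin.last d)

/-- The complex that results from `T` by stacking and identifying boundary facets. -/
def sigmaComplex {d : ℕ} (T : PreAbstractSimplicialComplex (Vertex d)) :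
    PreAbstractSimplicialComplex (Fin (d + 1) ⊕ (Fin d → Bool)) :=
  (stacked T).map (identify d)

/-- `sigmaComplex T` is really the quotient of the stacked complex by the identification of the
stacked boundary facets: no face degenerates, and distinct faces that become equal are both faces
of stacked boundary facets. -/
def IdentifiesOnlyStackedFacets {d : ℕ} (T : PreAbstractSimplicialComplex (Vertex d)) : Prop :=
  (∀ S ∈ (stacked T).faces, Set.InjOn (identify d) S) ∧
  ∀ S ∈ (stacked T).faces, ∀ S' ∈ (stacked T).faces,
    S.image (identify d) = S'.image (identify d) →
      S = S' ∨ ((∃ s, S ⊆ stackedFacet s) ∧ ∃ s', S' ⊆ stackedFacet s')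

end Antiprism

/-! The triangulation is the flag complex of `Compatible`: comparable sign vectors of the cube span
simplices, and these are joined to the signed unit vectors whose signs they share. It is regular
because `cubeHeight` is strictly submodular, which yields the order triangulation of the cube, while
the cross-polytope vertices get one common, very large height. `exists_affineMap_touching` and
`exists_tilt` give every clique a supporting affine function; `compatible_of_touching` shows that
every touched set is a clique.

A maximal simplex with a single cube vertex `s` is the boundary facet `s` joined to `s`. Stacking
replaces it by the simplices `stackFacet s i`, except when `s` is the all-positive vector, called
top. Every other facet of the quotient is a `chainFacet`: an interval of a maximal chain of sign
vectors together with the labels of the coordinates that are constant on it. The identification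
creates no further coincidences, since a cube vertex in a face recovers all signs and the stacking
vertex.

The facets at the stacking vertex are shelled first: all `stackFacet s i` with the same `i` share
the ridge opposite to `s`. Chain facets avoiding top follow by increasing number of cube vertices,
then those containing top by decreasing number. Chain facets with the same ends are compared as in a
lexicographic shelling: a chain that is not first has a descent, and exchanging the two steps there
gives an earlier chain (`exists_descent`, `exists_swap`). Every facet also has a ridge in no earlier
facet (`exists_new_ridge`), so the shelling run backwards is a collapse. Finally, every ridge except
the unstacked boundary facet has a second facet across it, which leaves exactly one free face. -/

namespace PreAbstractSimplicialComplex

/-! ### Collapses, shellings and free faces of complexes given by their facets -/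

/-- Deleting a free face together with the only face containing it leaves a complex. -/
theorem exists_elementaryCollapse {V : Type*} (K : PreAbstractSimplicialComplex V)
    {s t : Finset V} (hs : s ∈ K.faces) (ht : t ∈ K.faces) (hst : s ⊂ t)
    (h : ∀ u ∈ K.faces, s ⊂ u → u = t) :
    ∃ L : PreAbstractSimplicialComplex V, L.faces = K.faces \ {s, t} ∧ ElementaryCollapse K L := by
  refine ⟨⟨K.faces \ {s, t}, ?_⟩, rfl, s, t, hs, ht, hst, h, rfl⟩
  rintro u ⟨hu, hu'⟩
  refine ⟨(K.isRelLowerSet_faces hu).1, fun G hGu hG => ⟨(K.isRelLowerSet_faces hu).2 hGu hG, ?_⟩⟩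
  rintro (rfl | hGt)
  · rcases eq_or_ne G u with rfl | hne
    · exact hu' (Or.inl rfl)
    · exact hu' (Or.inr (h u hu (lt_of_le_of_ne hGu hne)))
  · obtain rfl : G = t := hGt
    exact hu' (Or.inr (h u hu (lt_of_lt_of_le hst hGu)))

/-- `K` collapses to a subcomplex `L` if the faces of `K` outside `L` are matched in pairs by
adding and removing one fixed vertex. -/
theorem collapses_of_toggle {V : Type*} [DecidableEq V] (v : V)
    (L : PreAbstractSimplicialComplex V) :
    ∀ (n : ℕ) (K : PreAbstractSimplicialComplex V), (K.faces \ L.faces).Finite →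
      (K.faces \ L.faces).ncard = n → L.faces ⊆ K.faces →
      (∀ G ∈ K.faces \ L.faces, insert v G ∈ K.faces \ L.faces ∧ G.erase v ∈ K.faces \ L.faces) →
      Relation.ReflTransGen ElementaryCollapse K L := by
  intro n
  induction n using Nat.strong_induction_on with
  | _ n ih =>
    intro K hfin hn hLK htog
    by_cases hne : (K.faces \ L.faces).Nonempty
    · obtain ⟨G₀, hG₀⟩ := hne
      have hfin' : {G | G ∈ K.faces \ L.faces ∧ v ∉ G}.Finite := hfin.subset fun G hG => hG.1
      -- A largest unmatched face without `v` is free: erasing `v` from a face properly above it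
      -- gives a face without `v` that is no larger, so only `insert v G` lies above.
      obtain ⟨G, ⟨hG, hvG⟩, hmax⟩ := hfin'.exists_maximalFor Finset.card _
        ⟨G₀.erase v, (htog G₀ hG₀).2, Finset.notMem_erase v G₀⟩
      have hmax' : ∀ u ∈ K.faces, G ⊂ u → u = insert v G := by
        intro u hu hGu
        have huL : u ∉ L.faces := fun h =>
          hG.2 ((L.isRelLowerSet_faces h).2 hGu.1 (K.isRelLowerSet_faces hG.1).1)
        have hsub : G ⊆ u.erase v := fun x hx =>
          Finset.mem_erase.2 ⟨fun h => hvG (h ▸ hx), hGu.1 hx⟩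
        have h1 := hmax ⟨(htog u ⟨hu, huL⟩).2, Finset.notMem_erase v u⟩ (Finset.card_le_card hsub)
        have h2 : G = u.erase v := Finset.eq_of_subset_of_card_le hsub h1
        have hvu : v ∈ u := by
          by_contra hvu
          rw [Finset.erase_eq_of_notMem hvu] at h2
          exact hGu.ne h2
        rw [h2, Finset.insert_erase hvu]
      obtain ⟨K', hK', hcol⟩ := exists_elementaryCollapse K hG.1 (htog G hG).1.1
        (Finset.ssubset_insert hvG) hmax'
      refine Relation.ReflTransGen.head hcol ?_
      have hsub : K'.faces \ L.faces ⊆ K.faces \ L.faces := by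
        rw [hK']; exact fun x hx => ⟨hx.1.1, hx.2⟩
      have hss : K'.faces \ L.faces ⊂ K.faces \ L.faces := by
        refine ⟨hsub, fun h => ?_⟩
        have := (h hG).1
        rw [hK'] at this
        exact this.2 (Or.inl rfl)
      refine ih _ (hn ▸ Set.ncard_lt_ncard hss hfin) K' (hfin.subset hsub) rfl ?_ ?_
      · rw [hK']
        refine fun x hx => ⟨hLK hx, ?_⟩
        rintro (rfl | h)
        · exact hG.2 hx
        · obtain rfl : x = _ := h
          exact (htog G hG).1.2 hx
      · intro u hu
        have huK := hsub hu
        have hu2 := hu.1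
        rw [hK'] at hu2 ⊢
        obtain ⟨-, hu2⟩ := hu2
        simp only [Set.mem_insert_iff, Set.mem_singleton_iff, not_or] at hu2
        refine ⟨⟨⟨(htog u huK).1.1, ?_⟩, (htog u huK).1.2⟩, ⟨⟨(htog u huK).2.1, ?_⟩, (htog u huK).2.2⟩⟩
        · rintro (h | h)
          · exact hvG (h ▸ Finset.mem_insert_self v u)
          · have h : insert v u = insert v G := h
            by_cases hvu : v ∈ u
            · rw [Finset.insert_eq_of_mem hvu] at h; exact hu2.2 h
            · apply hu2.1
              rw [← Finset.erase_insert hvu, h, Finset.erase_insert hvG]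
        · rintro (h | h)
          · by_cases hvu : v ∈ u
            · apply hu2.2; rw [← h, Finset.insert_erase hvu]
            · rw [Finset.erase_eq_of_notMem hvu] at h; exact hu2.1 h
          · have h : u.erase v = insert v G := h
            exact Finset.notMem_erase v u (h ▸ Finset.mem_insert_self v G)
    · have : K.faces = L.faces := by
        refine Set.Subset.antisymm (fun x hx => ?_) hLK
        by_contra hxL
        exact hne ⟨x, hx, hxL⟩
      have : K = L := PreAbstractSimplicialComplex.ext this
      rw [this]

/-- The complex generated by the sets `F i` with `i < j`. -/
def generatedBelow {V : Type*} {m : ℕ} (F : Fin m → Finset V) (j : ℕ) :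
    PreAbstractSimplicialComplex V where
  faces := {G | G.Nonempty ∧ ∃ i : Fin m, i.1 < j ∧ G ⊆ F i}
  isRelLowerSet_faces := by
    rintro G ⟨hG, i, hi, hGi⟩
    exact ⟨hG, fun G' hG' hne => ⟨hne, i, hi, hG'.trans hGi⟩⟩

/-- A complex generated by a shelling in which no facet closes up a sphere is collapsible. -/
theorem isCollapsible_of_order {V : Type*} [DecidableEq V]
    (K : PreAbstractSimplicialComplex V) {m : ℕ} (hm : 0 < m) (F : Fin m → Finset V)
    (hK : ∀ G, G ∈ K.faces ↔ G.Nonempty ∧ ∃ i, G ⊆ F i) (hF : ∀ i, (F i).Nonempty)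
    (hshell : ∀ i j : Fin m, j < i → ∃ v ∈ F i, v ∉ F j ∧ ∃ k < i, (F i).erase v ⊆ F k)
    (hfree : ∀ i : Fin m, ∃ v ∈ F i, ∀ k < i, ¬ (F i).erase v ⊆ F k) : K.IsCollapsible := by
  have hfin : ∀ j (S : Set (Finset V)), ((generatedBelow F j).faces \ S).Finite := by
    intro j S
    have : (⋃ i : Fin m, ((F i).powerset : Set (Finset V))).Finite :=
      Set.finite_iUnion fun i => Finset.finite_toSet _
    refine this.subset ?_
    rintro G ⟨⟨-, i, -, hi⟩, -⟩
    exact Set.mem_iUnion.2 ⟨i, by simpa using hi⟩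
  have hstep : ∀ j : ℕ, j < m →
      Relation.ReflTransGen ElementaryCollapse (generatedBelow F (j + 1)) (generatedBelow F 1) := by
    intro j
    induction j with
    | zero => intro _; exact Relation.ReflTransGen.refl
    | succ j ih =>
      intro hj
      refine Relation.ReflTransGen.trans ?_ (ih (by omega))
      set i : Fin m := ⟨j + 1, hj⟩ with hi
      obtain ⟨v, hv, hv'⟩ := hfree i
      -- The faces that `F i` adds are those containing every vertex whose opposite ridge is old.
      -- The ridge opposite to `v` is new, so adding or removing `v` preserves this family.
      refine collapses_of_toggle v _ _ _ (hfin _ _) rfl ?_ ?_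
      · rintro G ⟨hG, k, hk, hGk⟩
        exact ⟨hG, k, by omega, hGk⟩
      · rintro G ⟨⟨hG, k, hk, hGk⟩, hG'⟩
        have hnot : ∀ k : Fin m, k < i → ¬ G ⊆ F k := fun k hk h => hG' ⟨hG, k, hk, h⟩
        have hki : k = i := by
          by_contra hne
          exact hnot k (lt_of_le_of_ne (Nat.lt_succ_iff.mp hk) hne) hGk
        subst hki
        have herase : ∀ l : Fin m, l < i → ¬ G.erase v ⊆ F l := by
          intro l hl h
          -- If `G.erase v` lay in `F l`, the vertex `w` outside `F l` would be `v`, whose ridge is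
          -- new, or would be missing from `G`, which would put `G` in an old ridge.
          obtain ⟨w, hw, hwl, l', hl', hsub⟩ := hshell i l hl
          by_cases hwv : w = v
          · subst hwv; exact hv' l' hl' hsub
          · apply hnot l' hl'
            intro x hx
            refine hsub (Finset.mem_erase.2 ⟨?_, hGk hx⟩)
            rintro rfl
            exact hwl (h (Finset.mem_erase.2 ⟨hwv, hx⟩))
        refine ⟨⟨⟨Finset.insert_nonempty _ _, i, hk, Finset.insert_subset hv hGk⟩, ?_⟩,
          ⟨⟨?_, i, hk, (Finset.erase_subset _ _).trans hGk⟩, ?_⟩⟩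
        · rintro ⟨-, l, hl, hl'⟩
          exact hnot l hl ((Finset.subset_insert _ _).trans hl')
        · rw [Finset.nonempty_iff_ne_empty]
          intro h
          exact herase ⟨0, hm⟩ (Nat.succ_pos j) (by rw [h]; exact Finset.empty_subset _)
        · rintro ⟨-, l, hl, hl'⟩
          exact herase l hl hl'
  obtain ⟨v, hv⟩ := hF ⟨0, hm⟩
  refine ⟨⟨{{v}}, ?_⟩, v, rfl, ?_⟩
  · rintro G rfl
    refine ⟨Finset.singleton_nonempty v, fun G' hG' hne => ?_⟩
    exact (Finset.subset_singleton_iff.mp hG').resolve_left hne.ne_empty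
  · have hKm : K = generatedBelow F (m - 1 + 1) := by
      apply PreAbstractSimplicialComplex.ext
      ext G
      rw [hK]
      exact and_congr_right fun _ => exists_congr fun i => by
        have := i.2
        constructor
        · exact fun h => ⟨by omega, h⟩
        · exact fun h => h.2
    rw [hKm]
    refine (hstep (m - 1) (by omega)).trans ?_
    -- What remains is one simplex. Toggling `v` pairs all its nonempty faces except `{v}`, whose
    -- partner would be the empty set.
    refine collapses_of_toggle v _ _ _ (hfin _ _) rfl ?_ ?_
    · rintro G rfl
      exact ⟨Finset.singleton_nonempty v, ⟨0, hm⟩, Nat.one_pos, by simpa using hv⟩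
    · rintro G ⟨⟨hG, k, hk, hGk⟩, hG'⟩
      obtain rfl : k = ⟨0, hm⟩ := Fin.ext (by simpa using hk)
      have hG' : G ≠ {v} := hG'
      have hex : (G.erase v).Nonempty := by
        rw [Finset.nonempty_iff_ne_empty]
        intro h
        rcases Finset.erase_eq_empty_iff _ _ |>.mp h with h | h
        · exact hG.ne_empty h
        · exact hG' h
      refine ⟨⟨⟨Finset.insert_nonempty _ _, _, hk, Finset.insert_subset hv hGk⟩, ?_⟩,
        ⟨⟨hex, _, hk, (Finset.erase_subset _ _).trans hGk⟩, ?_⟩⟩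
      · intro h
        have h : insert v G = {v} := h
        obtain ⟨x, hx⟩ := hex
        have := h ▸ Finset.mem_insert_of_mem (Finset.mem_of_mem_erase hx)
        exact Finset.ne_of_mem_erase hx (Finset.mem_singleton.mp this)
      · intro h
        have h : G.erase v = {v} := h
        exact Finset.notMem_erase v G (h ▸ Finset.mem_singleton_self v)

/-- In a complex generated by a family of sets of equal size, the facets are the members of the
family. -/
theorem isFacet_iff_of_generated {V : Type*} {K : PreAbstractSimplicialComplex V}
    {𝓕 : Set (Finset V)} {n : ℕ} (hn : 0 < n) (hcard : ∀ F ∈ 𝓕, F.card = n)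
    (hK : ∀ G, G ∈ K.faces ↔ G.Nonempty ∧ ∃ F ∈ 𝓕, G ⊆ F) (s : Finset V) :
    K.IsFacet s ↔ s ∈ 𝓕 := by
  have hne : ∀ F ∈ 𝓕, F.Nonempty := fun F hF => Finset.card_pos.1 (by rw [hcard F hF]; exact hn)
  constructor
  · intro h
    obtain ⟨F, hF, hsF⟩ := ((hK s).1 h.prop).2
    have := h.le_of_ge ((hK F).2 ⟨hne F hF, F, hF, subset_rfl⟩) hsF
    rwa [le_antisymm hsF this]
  · intro h
    refine ⟨(hK s).2 ⟨hne s h, s, h, subset_rfl⟩, fun t ht hst => ?_⟩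
    obtain ⟨F, hF, htF⟩ := ((hK t).1 ht).2
    have : s = F := Finset.eq_of_subset_of_card_le (hst.trans htF) (by rw [hcard F hF, hcard s h])
    exact this ▸ htF

/-- A criterion for being shellable and collapsible: the facets are given as a family of sets of
equal size with a key, such that every earlier facet is separated from a facet `F` by removing a
vertex of `F` whose opposite ridge lies in a facet with a smaller key, and such that every `F` has
a ridge that lies in no facet with a smaller key. -/
theorem isShellable_and_isCollapsible_of_key {V α : Type*} [DecidableEq V] [LinearOrder α]
    {K : PreAbstractSimplicialComplex V} (𝓕 : Set (Finset V)) (hfin : 𝓕.Finite)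
    (hne : 𝓕.Nonempty) {n : ℕ} (hn : 0 < n) (hcard : ∀ F ∈ 𝓕, F.card = n)
    (hK : ∀ G, G ∈ K.faces ↔ G.Nonempty ∧ ∃ F ∈ 𝓕, G ⊆ F) (key : Finset V → α)
    (hshell : ∀ F ∈ 𝓕, ∀ F' ∈ 𝓕, F' ≠ F → key F' ≤ key F →
      ∃ v ∈ F, v ∉ F' ∧ ∃ F'' ∈ 𝓕, F.erase v ⊆ F'' ∧ key F'' < key F)
    (hfree : ∀ F ∈ 𝓕, ∃ v ∈ F, ∀ F'' ∈ 𝓕, F.erase v ⊆ F'' → ¬ key F'' < key F) :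
    K.IsShellable ∧ K.IsCollapsible := by
  have : Fintype 𝓕 := hfin.fintype
  let e := (Fintype.equivFin 𝓕).symm
  -- Facets with equal keys are listed in arbitrary order; only a strict inequality of keys
  -- determines which comes first.
  let σ := Tuple.sort fun i => key (e i)
  have hmono : Monotone fun i => key (e (σ i)) := Tuple.monotone_sort fun i => key (e i)
  let F : Fin (Fintype.card 𝓕) → Finset V := fun i => (e (σ i)).1
  have hFmem : ∀ i, F i ∈ 𝓕 := fun i => (e (σ i)).2
  have hinj : Function.Injective F :=
    Subtype.val_injective.comp (e.injective.comp σ.injective)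
  have hsurj : ∀ G ∈ 𝓕, ∃ i, F i = G := fun G hG =>
    ⟨σ.symm (e.symm ⟨G, hG⟩), by simp [F]⟩
  have hlt : ∀ i j, key (F i) < key (F j) → i < j := fun i j h =>
    lt_of_not_ge fun hji => absurd (hmono hji) (not_le.2 h)
  have hsh : ∀ i j, j < i → ∃ v ∈ F i, v ∉ F j ∧ ∃ k, k < i ∧ (F i).erase v ⊆ F k := by
    intro i j hji
    obtain ⟨v, hv, hvj, F'', hF'', hsub, hkey⟩ := hshell (F i) (hFmem i) (F j) (hFmem j)
      (fun h => hji.ne (hinj h)) (hmono hji.le)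
    obtain ⟨k, rfl⟩ := hsurj F'' hF''
    exact ⟨v, hv, hvj, k, hlt _ _ hkey, hsub⟩
  have hFne : ∀ i, (F i).Nonempty := fun i =>
    Finset.card_pos.1 (by rw [hcard _ (hFmem i)]; exact hn)
  have hfac := isFacet_iff_of_generated hn hcard hK
  refine ⟨⟨⟨n, fun s hs => hcard s ((hfac s).1 hs)⟩, _, F, hinj, ?_, ?_⟩, ?_⟩
  · ext s
    simp only [Set.mem_range, Set.mem_ofPred_eq, hfac]
    exact ⟨by rintro ⟨i, rfl⟩; exact hFmem i, hsurj s⟩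
  · intro i j hji
    obtain ⟨v, hv, hvj, k, hk, hsub⟩ := hsh i j hji
    have hvk : v ∉ F k := by
      intro hvk
      have h1 : F i ⊆ F k := by
        intro x hx
        by_cases hxv : x = v
        · exact hxv ▸ hvk
        · exact hsub (Finset.mem_erase.2 ⟨hxv, hx⟩)
      have h2 := Finset.eq_of_subset_of_card_le h1
        (by rw [hcard _ (hFmem i), hcard _ (hFmem k)])
      exact hk.ne (hinj h2).symm
    have hki : F k ∩ F i = (F i).erase v := by
      ext x
      simp only [Finset.mem_inter, Finset.mem_erase]
      exact ⟨fun h => ⟨fun hx => hvk (hx ▸ h.1), h.2⟩,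
        fun h => ⟨hsub (Finset.mem_erase.2 h), h.2⟩⟩
    refine ⟨k, hk, ?_, ?_⟩
    · rw [hki]
      intro x hx
      rw [Finset.mem_inter] at hx
      exact Finset.mem_erase.2 ⟨fun h => hvj (h ▸ hx.1), hx.2⟩
    · rw [hki, Finset.card_erase_add_one hv]
  · refine isCollapsible_of_order K (Fintype.card_pos_iff.2 hne.to_subtype) F (fun G => ?_) hFne
      hsh fun i => ?_
    · rw [hK]
      refine and_congr_right fun _ => ⟨?_, fun ⟨i, hi⟩ => ⟨F i, hFmem i, hi⟩⟩
      rintro ⟨G', hG', hsub⟩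
      obtain ⟨i, rfl⟩ := hsurj G' hG'
      exact ⟨i, hsub⟩
    · obtain ⟨v, hv, hv'⟩ := hfree (F i) (hFmem i)
      refine ⟨v, hv, fun k hk hsub => ?_⟩
      -- `F k` may tie with `F i`, so `hv'` does not apply to it directly. The shelling condition
      -- transfers the ridge to a facet with a strictly smaller key.
      obtain ⟨w, hw, hwk, F'', hF'', hsub', hkey⟩ := hshell (F i) (hFmem i) (F k) (hFmem k)
        (fun h => hk.ne (hinj h)) (hmono hk.le)
      by_cases hwv : w = v
      · subst hwv; exact hv' F'' hF'' hsub' hkey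
      · exact hwk (hsub (Finset.mem_erase.2 ⟨hwv, hw⟩))

/-- If `s` is a face in the complex generated by sets of equal size, and every ridge of the complex
other than `s` lies in two of these sets, then no other face is free. -/
theorem eq_of_isFreeFace_of_generated {V : Type*} [DecidableEq V]
    {K : PreAbstractSimplicialComplex V} {𝓕 : Set (Finset V)} {n : ℕ} (hn : 0 < n)
    (hcard : ∀ F ∈ 𝓕, F.card = n)
    (hK : ∀ G, G ∈ K.faces ↔ G.Nonempty ∧ ∃ F ∈ 𝓕, G ⊆ F) {s : Finset V}
    (hridge : ∀ F ∈ 𝓕, ∀ v ∈ F, F.erase v ≠ s → ∃ F' ∈ 𝓕, F' ≠ F ∧ F.erase v ⊆ F')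
    {u : Finset V} (hu : K.IsFreeFace u) : u = s := by
  obtain ⟨huK, t, ⟨ht, hut⟩, huniq⟩ := hu
  have hne : ∀ F ∈ 𝓕, F.Nonempty := fun F hF => Finset.card_pos.1 (by rw [hcard F hF]; exact hn)
  obtain ⟨F, hF, htF⟩ := ((hK t).1 ht).2
  have hFt : F = t := huniq F ⟨(hK F).2 ⟨hne F hF, F, hF, subset_rfl⟩, hut.trans_subset htF⟩
  subst hFt
  obtain ⟨v, hvF, hvu⟩ := Finset.exists_of_ssubset hut
  have huv : u ⊆ F.erase v := fun x hx => Finset.mem_erase.2 ⟨fun h => hvu (h ▸ hx), hut.1 hx⟩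
  -- A free face must be a ridge: otherwise both `F` and `F.erase v` would contain it properly.
  have heq : u = F.erase v := by
    by_contra hne'
    have hss : u ⊂ F.erase v := lt_of_le_of_ne huv hne'
    have := huniq (F.erase v) ⟨(hK _).2 ⟨((hK u).1 huK).1.mono huv, F, hF,
      Finset.erase_subset _ _⟩, hss⟩
    exact Finset.notMem_erase v F (by rw [this]; exact hvF)
  by_contra hus
  obtain ⟨F', hF', hne', hsub⟩ := hridge F hF v hvF (heq ▸ hus)
  refine hne' (huniq F' ⟨(hK _).2 ⟨hne F' hF', F', hF', subset_rfl⟩, ?_⟩)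
  rw [heq]
  refine lt_of_le_of_ne hsub fun h => ?_
  have := Finset.card_erase_add_one hvF
  rw [h, hcard F' hF', hcard F hF] at this
  omega

end PreAbstractSimplicialComplex

namespace Antiprism

/-! ### Chains of sign vectors -/

/-- The number of positive signs. -/
def rank {d : ℕ} (y : Fin d → Bool) : ℕ := (Finset.univ.filter fun i => y i = true).card

/-- The sign vector whose positive coordinates are the first `k` ones in the order given by `π`. -/
def stage {d : ℕ} (π : Equiv.Perm (Fin d)) (k : ℕ) : Fin d → Bool := fun i => decide ((π i : ℕ) < k)

theorem stage_eq_true {d : ℕ} {π : Equiv.Perm (Fin d)} {k : ℕ} {i : Fin d} :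
    stage π k i = true ↔ (π i : ℕ) < k := by simp [stage]

theorem stage_eq_false {d : ℕ} {π : Equiv.Perm (Fin d)} {k : ℕ} {i : Fin d} :
    stage π k i = false ↔ k ≤ (π i : ℕ) := by simp [stage]

theorem stage_mono {d : ℕ} (π : Equiv.Perm (Fin d)) {k l : ℕ} (h : k ≤ l) :
    stage π k ≤ stage π l := by
  intro i
  rw [Bool.le_iff_imp, stage_eq_true, stage_eq_true]
  omega

theorem rank_stage {d : ℕ} (π : Equiv.Perm (Fin d)) {k : ℕ} (hk : k ≤ d) :
    rank (stage π k) = k := by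
  have h : (Finset.univ.filter fun i => stage π k i = true).map π.toEmbedding =
      Finset.univ.filter fun i : Fin d => (i : ℕ) < k := by
    ext i
    simp [stage_eq_true, Finset.mem_map_equiv]
  rw [rank, ← Finset.card_map π.toEmbedding, h, Fin.card_filter_val_lt, min_eq_right hk]

theorem rank_le {d : ℕ} (y : Fin d → Bool) : rank y ≤ d :=
  (Finset.card_le_univ _).trans (Fintype.card_fin d).le

/-- The positive coordinates precede all negative ones under `π`, so they fill an initial segment
whose length is their number. -/
theorem eq_stage_of_forall_lt {d : ℕ} {π : Equiv.Perm (Fin d)} {y : Fin d → Bool}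
    (h : ∀ i j, y i = true → y j = false → π i < π j) : y = stage π (rank y) := by
  funext i
  cases hi : y i
  · symm
    rw [stage_eq_false, rank, ← Finset.card_map π.toEmbedding, ← Fin.card_Iio (π i)]
    refine Finset.card_le_card fun j hj => ?_
    obtain ⟨l, hl, rfl⟩ := Finset.mem_map.1 hj
    exact Finset.mem_Iio.2 (h l i (Finset.mem_filter.1 hl).2 hi)
  · symm
    rw [stage_eq_true, rank, ← Nat.succ_le_iff, Nat.succ_eq_add_one, ← Fin.card_Iic (π i),
      ← Finset.card_map π.toEmbedding (s := Finset.univ.filter _)]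
    refine Finset.card_le_card fun j hj => ?_
    rw [Finset.mem_map_equiv, Finset.mem_filter]
    refine ⟨Finset.mem_univ _, ?_⟩
    by_contra hj'
    have := h i (π.symm j) hi (by simpa using hj')
    rw [Equiv.apply_symm_apply] at this
    exact absurd (Finset.mem_Iic.1 hj) (not_le.2 this)

/-- A family of sign vectors that is totally ordered by `≤`. -/
def IsBoolChain {d : ℕ} (τ : Finset (Fin d → Bool)) : Prop :=
  ∀ y ∈ τ, ∀ z ∈ τ, y ≤ z ∨ z ≤ y

/-- Sort the coordinates by the number of members that are negative there. If a member is positive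
at `i` and negative at `j`, comparability makes every member negative at `i` also negative at `j`,
so the count at `i` is strictly smaller. -/
theorem IsBoolChain.exists_perm {d : ℕ} {τ : Finset (Fin d → Bool)} (hτ : IsBoolChain τ) :
    ∃ π : Equiv.Perm (Fin d), ∀ y ∈ τ, y = stage π (rank y) := by
  let f : Fin d → ℕ := fun i => (τ.filter fun y => y i = false).card
  refine ⟨(Tuple.sort f)⁻¹, fun y hy => eq_stage_of_forall_lt fun i j hi hj => ?_⟩
  have hlt : f i < f j := by
    refine Finset.card_lt_card ⟨fun z hz => ?_, fun h => ?_⟩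
    · rw [Finset.mem_filter] at hz ⊢
      refine ⟨hz.1, ?_⟩
      rcases hτ y hy z hz.1 with h | h
      · have := Bool.le_iff_imp.1 (h i) hi
        rw [hz.2] at this; cases this
      · by_contra hzj
        have := Bool.le_iff_imp.1 (h j) (by simpa using hzj)
        rw [hj] at this; cases this
    · have := (Finset.mem_filter.1 (h (Finset.mem_filter.2 ⟨hy, hj⟩))).2
      rw [hi] at this; cases this
  by_contra hle
  have := Tuple.monotone_sort f (not_lt.1 hle)
  simp only [Function.comp, ← Equiv.Perm.mul_apply, mul_inv_cancel, Equiv.Perm.one_apply] at this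
  omega

/-! ### Affine functions on the cube -/

theorem affineMap_sum_apply {ι E : Type*} [AddCommGroup E] [Module ℝ E] (s : Finset ι)
    (f : ι → E →ᵃ[ℝ] ℝ) (p : E) : (∑ i ∈ s, f i) p = ∑ i ∈ s, f i p := by
  classical
  induction s using Finset.induction_on with
  | empty => simp
  | insert a s ha ih => simp [Finset.sum_insert ha, ih]

/-- The affine function that takes the value `1` at the vertices of the cube with `i`-th sign
`+1`, and `0` at the others. -/
noncomputable def cubeCoord {d : ℕ} (i : Fin d) : (Fin d → ℝ) →ᵃ[ℝ] ℝ :=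
  (d : ℝ) • (LinearMap.proj i : (Fin d → ℝ) →ₗ[ℝ] ℝ).toAffineMap + AffineMap.const ℝ _ (1 / 2)

theorem cubeCoord_apply {d : ℕ} (i : Fin d) (p : Fin d → ℝ) :
    cubeCoord i p = d * p i + 1 / 2 := by
  simp [cubeCoord]

theorem cubeCoord_position {d : ℕ} (i : Fin d) (y : Fin d → Bool) :
    cubeCoord i (position d (Sum.inr y)) = if y i then 1 else 0 := by
  have hd : (d : ℝ) ≠ 0 := by
    have := i.pos
    positivity
  rw [cubeCoord_apply]
  cases h : y i <;> simp [position, sgn, h] <;> field_simp <;> norm_num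

/-- The height of the vertices of the cube: the number of ordered pairs of coordinates with
different signs. -/
def cubeHeight {d : ℕ} (y : Fin d → Bool) : ℝ := ∑ i, ∑ j, if y i = y j then 0 else 1

theorem cubeHeight_nonneg {d : ℕ} (y : Fin d → Bool) : 0 ≤ cubeHeight y :=
  Finset.sum_nonneg fun i _ => Finset.sum_nonneg fun j _ => by split_ifs <;> norm_num

/-- Each pair of coordinates contributes a submodular term. The inequality is strict for a pair on
which `y` and `z` differ in opposite directions: both signs agree in the meet and in the join. -/
theorem cubeHeight_inf_add_sup_lt {d : ℕ} {y z : Fin d → Bool} (hyz : ¬ y ≤ z) (hzy : ¬ z ≤ y) :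
    cubeHeight (y ⊓ z) + cubeHeight (y ⊔ z) < cubeHeight y + cubeHeight z := by
  have key : ∀ a b c e : Bool, ((if a ⊓ b = c ⊓ e then 0 else 1) + if a ⊔ b = c ⊔ e then 0 else 1 : ℝ)
      ≤ (if a = c then 0 else 1) + if b = e then 0 else 1 := by
    intro a b c e
    cases a <;> cases b <;> cases c <;> cases e <;> norm_num
  simp only [Pi.le_def, not_forall, Bool.le_iff_imp] at hyz hzy
  obtain ⟨i, hi, hi'⟩ := hyz
  obtain ⟨j, hj, hj'⟩ := hzy
  simp only [cubeHeight, ← Finset.sum_add_distrib]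
  refine Finset.sum_lt_sum (fun a _ => Finset.sum_le_sum fun b _ => key _ _ _ _)
    ⟨i, Finset.mem_univ _, Finset.sum_lt_sum (fun b _ => key _ _ _ _) ⟨j, Finset.mem_univ _, ?_⟩⟩
  simp only [Bool.not_eq_true] at hi' hj'
  simp [hi, hi', hj, hj']

/-- On the cube the height is a sum of terms `|yᵢ - yⱼ|` in 0/1 coordinates. Each is bounded below
by `±(yᵢ - yⱼ)` and by zero; the chain selects a bound that is sharp on all its members, and the
selected bounds are added. -/
theorem exists_affineMap_touching {d : ℕ} (hd : 0 < d) {τ : Finset (Fin d → Bool)}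
    (hτ : IsBoolChain τ) : ∃ f : (Fin d → ℝ) →ᵃ[ℝ] ℝ, ∀ y,
      f (position d (Sum.inr y)) ≤ cubeHeight y ∧
      (f (position d (Sum.inr y)) = cubeHeight y ↔ y ∈ τ) := by
  classical
  obtain ⟨π, hπ⟩ := hτ.exists_perm
  -- The pair terms cannot detect the two constant sign vectors, where they and the height all
  -- vanish. The corrections `f₀` and `f₁` push the bottom and the top vertex below their heights
  -- unless they belong to `τ`.
  obtain ⟨f₀, hf₀, hf₀τ, hf₀'⟩ : ∃ f : (Fin d → ℝ) →ᵃ[ℝ] ℝ,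
      (∀ y, f (position d (Sum.inr y)) ≤ 0) ∧ (∀ y ∈ τ, f (position d (Sum.inr y)) = 0) ∧
      (f (position d (Sum.inr (stage π 0))) = 0 → stage π 0 ∈ τ) := by
    by_cases h : stage π 0 ∈ τ
    · exact ⟨0, by simp, by simp, fun _ => h⟩
    · refine ⟨cubeCoord (π.symm ⟨0, hd⟩) - AffineMap.const ℝ _ 1, fun y => ?_, fun y hy => ?_, ?_⟩
      · simp only [AffineMap.coe_sub, Pi.sub_apply, cubeCoord_position, AffineMap.const_apply]
        split_ifs <;> norm_num
      · have h1 : y (π.symm ⟨0, hd⟩) = true := by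
          rw [hπ y hy, stage_eq_true]
          rcases Nat.eq_zero_or_pos (rank y) with h0 | h0
          · rw [hπ y hy, h0] at hy
            exact absurd hy h
          · simpa using h0
        simp [cubeCoord_position, h1]
      · simp [cubeCoord_position, stage]
  obtain ⟨f₁, hf₁, hf₁τ, hf₁'⟩ : ∃ f : (Fin d → ℝ) →ᵃ[ℝ] ℝ,
      (∀ y, f (position d (Sum.inr y)) ≤ 0) ∧ (∀ y ∈ τ, f (position d (Sum.inr y)) = 0) ∧
      (f (position d (Sum.inr (stage π d))) = 0 → stage π d ∈ τ) := by
    by_cases h : stage π d ∈ τ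
    · exact ⟨0, by simp, by simp, fun _ => h⟩
    · refine ⟨- cubeCoord (π.symm ⟨d - 1, by omega⟩), fun y => ?_, fun y hy => ?_, ?_⟩
      · simp only [AffineMap.coe_neg, Pi.neg_apply, cubeCoord_position]
        split_ifs <;> norm_num
      · have h1 : y (π.symm ⟨d - 1, by omega⟩) = false := by
          rw [hπ y hy, stage_eq_false]
          rcases eq_or_lt_of_le (rank_le y) with h0 | h0
          · rw [hπ y hy, h0] at hy
            exact absurd hy h
          · simp only [Equiv.apply_symm_apply]
            omega
        simp [cubeCoord_position, h1]
      · simp [cubeCoord_position, stage, hd]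
  -- Members of a chain cannot order `i` and `j` in opposite ways, so `B` picks the sign; if no
  -- member separates the two coordinates, the term is zero.
  let B : Fin d → Fin d → Prop := fun i j => ∃ z ∈ τ, z i = true ∧ z j = false
  let t : Fin d → Fin d → (Fin d → ℝ) →ᵃ[ℝ] ℝ := fun i j =>
    if B i j then cubeCoord i - cubeCoord j else if B j i then cubeCoord j - cubeCoord i else 0
  have hval : ∀ i j y, t i j (position d (Sum.inr y)) =
      if B i j then (if y i then 1 else 0) - (if y j then 1 else 0)
      else if B j i then (if y j then 1 else 0) - (if y i then 1 else 0) else 0 := by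
    intro i j y
    simp only [t, ← cubeCoord_position]
    split_ifs <;> rfl
  clear_value t
  have ht : ∀ i j y, t i j (position d (Sum.inr y)) ≤ if y i = y j then 0 else 1 := by
    intro i j y
    rw [hval]
    cases y i <;> cases y j <;> split_ifs <;> norm_num at *
  have htτ : ∀ i j, ∀ y ∈ τ, t i j (position d (Sum.inr y)) = if y i = y j then 0 else 1 := by
    intro i j y hy
    have hBB : ∀ i j, B i j → ¬ (y i = false ∧ y j = true) := by
      rintro i j ⟨z, hz, hzi, hzj⟩ ⟨hyi, hyj⟩
      rcases hτ y hy z hz with h | h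
      · have := Bool.le_iff_imp.1 (h j) hyj
        rw [hzj] at this; cases this
      · have := Bool.le_iff_imp.1 (h i) hzi
        rw [hyi] at this; cases this
    have hB : ∀ i j, y i = true → y j = false → B i j := fun i j hi hj => ⟨y, hy, hi, hj⟩
    have h1 := hBB i j
    have h2 := hBB j i
    have h3 := hB i j
    have h4 := hB j i
    rw [hval]
    cases hi : y i <;> cases hj : y j <;> simp only [hi, hj] at h1 h2 h3 h4 <;>
      split_ifs <;> norm_num at * <;> tauto
  have htB : ∀ i j y, y i = true → y j = false →
      t i j (position d (Sum.inr y)) = (if y i = y j then 0 else 1) → B i j := by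
    intro i j y hi hj h
    by_contra hB
    rw [hval, if_neg hB, hi, hj] at h
    split_ifs at h <;> norm_num at *
  have hle : ∀ y, ∑ i, ∑ j, t i j (position d (Sum.inr y)) ≤ cubeHeight y := fun y =>
    Finset.sum_le_sum fun i _ => Finset.sum_le_sum fun j _ => ht i j y
  refine ⟨∑ i, ∑ j, t i j + f₀ + f₁, fun y => ?_⟩
  simp only [AffineMap.coe_add, Pi.add_apply, affineMap_sum_apply]
  refine ⟨by linarith [hle y, hf₀ y, hf₁ y], fun h => ?_, fun hy => ?_⟩
  · have h0 : f₀ (position d (Sum.inr y)) = 0 := by linarith [hle y, hf₀ y, hf₁ y]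
    have h1 : f₁ (position d (Sum.inr y)) = 0 := by linarith [hle y, hf₀ y, hf₁ y]
    have h2 : ∑ i, ∑ j, t i j (position d (Sum.inr y)) = cubeHeight y := by
      linarith [hle y, hf₀ y, hf₁ y]
    have h3 : ∀ i j, t i j (position d (Sum.inr y)) = if y i = y j then 0 else 1 := by
      intro i j
      have h4 := (Finset.sum_eq_sum_iff_of_le fun i _ => Finset.sum_le_sum fun j _ =>
        ht i j y).1 h2 i (Finset.mem_univ _)
      exact (Finset.sum_eq_sum_iff_of_le fun j _ => ht i j y).1 h4 j (Finset.mem_univ _)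
    have h4 : ∀ i j, y i = true → y j = false → B i j := fun i j hi hj =>
      htB i j y hi hj (h3 i j)
    have h5 : y = stage π (rank y) := by
      refine eq_stage_of_forall_lt fun i j hi hj => ?_
      obtain ⟨z, hz, hzi, hzj⟩ := h4 i j hi hj
      rw [hπ z hz] at hzi hzj
      rw [stage_eq_true] at hzi
      rw [stage_eq_false] at hzj
      exact Fin.lt_def.2 (by omega)
    rcases Nat.eq_zero_or_pos (rank y) with hr | hr
    · rw [hr] at h5
      rw [h5] at h0 ⊢
      exact hf₀' h0
    · rcases eq_or_lt_of_le (rank_le y) with hr' | hr'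
      · rw [hr'] at h5
        rw [h5] at h1 ⊢
        exact hf₁' h1
      · have hy : ∀ i, y i = stage π (rank y) i := fun i => congrFun h5 i
        -- Apply sharpness at the two positions next to the cut of `y`. A member of `τ` separating
        -- them has its cut at the same place, hence equals `y`.
        obtain ⟨z, hz, hzi, hzj⟩ := h4 (π.symm ⟨rank y - 1, by omega⟩) (π.symm ⟨rank y, hr'⟩)
          (by rw [hy, stage_eq_true, Equiv.apply_symm_apply, Fin.val_mk]; omega)
          (by rw [hy, stage_eq_false, Equiv.apply_symm_apply])
        have hz' := hπ z hz
        rw [hz', stage_eq_true] at hzi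
        rw [hz', stage_eq_false] at hzj
        simp only [Equiv.apply_symm_apply] at hzi hzj
        have : rank z = rank y := by omega
        rw [h5, ← this, ← hz']
        exact hz
  · rw [hf₀τ y hy, hf₁τ y hy, add_zero, add_zero]
    exact Finset.sum_congr rfl fun i _ => Finset.sum_congr rfl fun j _ => htτ i j y hy

end Antiprism

/-- Evaluating `f` on a vanishing combination with weights of sum zero leaves only the weight at `v`
times `f (p v)`. -/
theorem affineIndependent_of_exists_affineMap {V E : Type*} [AddCommGroup E] [Module ℝ E]
    {p : V → E} {S : Finset V}
    (h : ∀ v ∈ S, ∃ f : E →ᵃ[ℝ] ℝ, f (p v) ≠ 0 ∧ ∀ u ∈ S, u ≠ v → f (p u) = 0) :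
    AffineIndependent ℝ (fun v : S => p v) := by
  rw [affineIndependent_iff]
  intro s w hw hwp v hv
  obtain ⟨f, hfv, hf⟩ := h v v.2
  have hsum : ∑ u ∈ s, w u * f (p u) = 0 := by
    have : ∀ u : S, w u * f (p u) = f.linear (w u • p u) + w u * f 0 := by
      intro u
      rw [map_smul, f.decomp]
      simp [mul_add]
    simp only [this, Finset.sum_add_distrib, ← map_sum, ← Finset.sum_mul, hw, hwp]
    simp
  rw [Finset.sum_eq_single v] at hsum
  · exact (mul_eq_zero.1 hsum).resolve_right hfv
  · intro u _ huv
    rw [hf u u.2 (fun h => huv (Subtype.ext h)), mul_zero]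
  · exact fun h => absurd hv h

namespace Antiprism

/-! ### The triangulation -/

/-- The edges of the triangulation. -/
def Compatible {d : ℕ} : Vertex d → Vertex d → Prop
  | Sum.inl a, Sum.inl b => a.1 = b.1 → a.2 = b.2
  | Sum.inl a, Sum.inr y => y a.1 = a.2
  | Sum.inr y, Sum.inl a => y a.1 = a.2
  | Sum.inr y, Sum.inr z => y ≤ z ∨ z ≤ y

/-- The triangulation of the antiprism subdivision that induces the staircase triangulation on all
faces of the cube. -/
def staircase (d : ℕ) : PreAbstractSimplicialComplex (Vertex d) where
  faces := {S | S.Nonempty ∧ ∀ u ∈ S, ∀ v ∈ S, Compatible u v}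
  isRelLowerSet_faces := by
    rintro S ⟨hS, hc⟩
    exact ⟨hS, fun S' hS' hne => ⟨hne, fun u hu v hv => hc u (hS' hu) v (hS' hv)⟩⟩

/-- The signed coordinates of the vertices of the cross-polytope in `S`. -/
def crossPart {d : ℕ} (S : Finset (Vertex d)) : Finset (Fin d × Bool) :=
  Finset.univ.filter fun a => Sum.inl a ∈ S

/-- The vertices of the cube in `S`. -/
def cubePart {d : ℕ} (S : Finset (Vertex d)) : Finset (Fin d → Bool) :=
  Finset.univ.filter fun y => Sum.inr y ∈ S

theorem mem_crossPart {d : ℕ} {S : Finset (Vertex d)} {a : Fin d × Bool} :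
    a ∈ crossPart S ↔ Sum.inl a ∈ S := by simp [crossPart]

theorem mem_cubePart {d : ℕ} {S : Finset (Vertex d)} {y : Fin d → Bool} :
    y ∈ cubePart S ↔ Sum.inr y ∈ S := by simp [cubePart]

theorem isBoolChain_cubePart {d : ℕ} {S : Finset (Vertex d)} (hS : S ∈ (staircase d).faces) :
    IsBoolChain (cubePart S) := fun y hy z hz =>
  hS.2 (Sum.inr y) (mem_cubePart.1 hy) (Sum.inr z) (mem_cubePart.1 hz)

/-- The affine function `p ↦ ± d pᵢ - 1 / 2`, which vanishes at the vertices of the cube with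
`i`-th sign as prescribed, and is `-1` at the other vertices of the cube. -/
noncomputable def signCoord {d : ℕ} (a : Fin d × Bool) : (Fin d → ℝ) →ᵃ[ℝ] ℝ :=
  (sgn a.2 * d : ℝ) • (LinearMap.proj a.1 : (Fin d → ℝ) →ₗ[ℝ] ℝ).toAffineMap -
    AffineMap.const ℝ _ (1 / 2)

theorem signCoord_apply {d : ℕ} (a : Fin d × Bool) (p : Fin d → ℝ) :
    signCoord a p = sgn a.2 * d * p a.1 - 1 / 2 := by
  simp [signCoord]

theorem signCoord_cube {d : ℕ} (a : Fin d × Bool) (y : Fin d → Bool) :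
    signCoord a (position d (Sum.inr y)) = if y a.1 = a.2 then 0 else -1 := by
  have hd : (d : ℝ) ≠ 0 := by
    have := a.1.pos
    positivity
  rw [signCoord_apply]
  obtain ⟨i, b⟩ := a
  cases h : y i <;> cases b <;> simp [position, sgn, h] <;> field_simp <;> norm_num

theorem signCoord_cross_le {d : ℕ} {a b : Fin d × Bool} (h : a ≠ b) :
    signCoord a (position d (Sum.inl b)) ≤ - (1 / 2) := by
  rw [signCoord_apply]
  obtain ⟨i, s⟩ := a
  obtain ⟨j, t⟩ := b
  rcases eq_or_ne i j with rfl | hij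
  · have hst : s ≠ t := fun hst => h (by rw [hst])
    cases s <;> cases t <;> simp_all [position, sgn]
  · simp [position, hij]

theorem signCoord_cross_eq {d : ℕ} {A : Finset (Fin d × Bool)} (hA : IsProperFace A)
    {a b : Fin d × Bool} (ha : a ∈ A) (hb : b ∈ A) :
    signCoord a (position d (Sum.inl b)) = (if a = b then (d : ℝ) else 0) - 1 / 2 := by
  rw [signCoord_apply]
  obtain ⟨i, s⟩ := a
  obtain ⟨j, t⟩ := b
  rcases eq_or_ne i j with rfl | hij
  · obtain rfl : s = t := by
      have := hA i
      cases s <;> cases t <;> simp_all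
    cases s <;> simp [position, sgn]
  · simp [position, hij]

theorem card_le_of_isProperFace {d : ℕ} {A : Finset (Fin d × Bool)} (hA : IsProperFace A) :
    A.card ≤ d := by
  have : Set.InjOn Prod.fst (A : Set (Fin d × Bool)) := by
    rintro ⟨i, s⟩ ha ⟨j, t⟩ hb (rfl : i = j)
    have := hA i
    cases s <;> cases t <;> simp_all
  rw [← Finset.card_image_of_injOn this]
  exact (Finset.card_le_univ _).trans (Fintype.card_fin d).le

/-- An affine function that is below the heights of the cube vertices can be tilted so that it
touches the height `M` exactly at the vertices in the proper face `A` of the cross-polytope, and is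
lowered at the cube vertices outside the dual face of `A`. -/
theorem exists_tilt {d : ℕ} (hd : 0 < d) {A : Finset (Fin d × Bool)} (hA : IsProperFace A)
    (g : (Fin d → ℝ) →ᵃ[ℝ] ℝ) {M : ℝ} (hM : ∀ b, g (position d (Sum.inl b)) < M) :
    ∃ f : (Fin d → ℝ) →ᵃ[ℝ] ℝ,
      (∀ b, f (position d (Sum.inl b)) ≤ M ∧ (f (position d (Sum.inl b)) = M ↔ b ∈ A)) ∧
      ∀ y, f (position d (Sum.inr y)) ≤ g (position d (Sum.inr y)) ∧
        ((∀ a ∈ A, y a.1 = a.2) → f (position d (Sum.inr y)) = g (position d (Sum.inr y))) ∧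
        (f (position d (Sum.inr y)) = g (position d (Sum.inr y)) → ∀ a ∈ A, y a.1 = a.2) := by
  classical
  have hd' : (0 : ℝ) < d := by exact_mod_cast hd
  have hcard : (A.card : ℝ) ≤ d := by exact_mod_cast card_le_of_isProperFace hA
  -- Touching `M` at `b ∈ A` requires `lam b * d - μ / 2 = M - g (position d (Sum.inl b))`, where
  -- `μ` is the sum of the coefficients over `A`. Summing these equations gives `q * μ`, and `q` is
  -- positive because `A` has at most `d` elements.
  set q : ℝ := 1 - A.card / (2 * d) with hq
  have hqpos : 0 < q := by
    rw [hq, sub_pos, div_lt_one (by positivity)]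
    linarith
  set μ : ℝ := (∑ a ∈ A, (M - g (position d (Sum.inl a))) / d) / q with hμ
  have hμ0 : 0 ≤ μ := div_nonneg (Finset.sum_nonneg fun a _ =>
    div_nonneg (by linarith [hM a]) hd'.le) hqpos.le
  set lam : Fin d × Bool → ℝ := fun a => (M - g (position d (Sum.inl a)) + μ / 2) / d with hlam
  have hlam0 : ∀ a, 0 < lam a := fun a => div_pos (by linarith [hM a]) hd'
  have hsum : ∑ a ∈ A, lam a = μ := by
    have h1 : ∑ a ∈ A, lam a = q * μ + A.card * (μ / 2 / d) := by
      rw [hμ, mul_div_cancel₀ _ hqpos.ne', ← hμ, ← nsmul_eq_mul, ← Finset.sum_const,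
        ← Finset.sum_add_distrib]
      exact Finset.sum_congr rfl fun a _ => by simp only [hlam, add_div]
    rw [h1, hq]
    field_simp
    ring
  have hf : ∀ p, (g + ∑ a ∈ A, lam a • signCoord a) p = g p + ∑ a ∈ A, lam a * signCoord a p := by
    intro p
    rw [AffineMap.coe_add, Pi.add_apply, affineMap_sum_apply]
    rfl
  refine ⟨g + ∑ a ∈ A, lam a • signCoord a, fun b => ?_, fun y => ?_⟩
  · rw [hf]
    by_cases hb : b ∈ A
    · have h1 : ∑ a ∈ A, lam a * signCoord a (position d (Sum.inl b)) = lam b * d - μ / 2 := by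
        rw [← hsum, Finset.sum_div]
        have : ∀ a ∈ A, lam a * signCoord a (position d (Sum.inl b)) =
            (if a = b then lam a * d else 0) - lam a / 2 := by
          intro a ha
          rw [signCoord_cross_eq hA ha hb]
          split_ifs <;> ring
        rw [Finset.sum_congr rfl this, Finset.sum_sub_distrib, Finset.sum_ite_eq', if_pos hb]
      have h2 : g (position d (Sum.inl b)) + (lam b * d - μ / 2) = M := by
        rw [hlam]
        field_simp
        ring
      rw [h1, h2]
      exact ⟨le_rfl, by simp [hb]⟩
    · have h1 : ∑ a ∈ A, lam a * signCoord a (position d (Sum.inl b)) ≤ 0 :=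
        Finset.sum_nonpos fun a ha => mul_nonpos_of_nonneg_of_nonpos (hlam0 a).le
          ((signCoord_cross_le fun h : a = b => hb (h ▸ ha)).trans (by norm_num))
      have h2 := hM b
      exact ⟨by linarith, fun h => by linarith, fun h => absurd h hb⟩
  · rw [hf]
    have h1 : ∀ a ∈ A, lam a * signCoord a (position d (Sum.inr y)) ≤ 0 := fun a _ => by
      rw [signCoord_cube]
      refine mul_nonpos_of_nonneg_of_nonpos (hlam0 a).le ?_
      split_ifs <;> norm_num
    have h2 := Finset.sum_nonpos h1
    refine ⟨by linarith, fun h => ?_, fun h a ha => ?_⟩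
    · rw [Finset.sum_eq_zero, add_zero]
      intro a ha
      rw [signCoord_cube, if_pos (h a ha), mul_zero]
    · have h3 := (Finset.sum_eq_zero_iff_of_nonpos h1).1 (by linarith) a ha
      by_contra hne
      rw [signCoord_cube, if_neg hne] at h3
      linarith [hlam0 a]

theorem position_inf_add_sup {d : ℕ} (y z : Fin d → Bool) :
    position d (Sum.inr (y ⊓ z)) + position d (Sum.inr (y ⊔ z)) =
      position d (Sum.inr y) + position d (Sum.inr z) := by
  funext i
  simp only [position, Pi.add_apply, Pi.inf_apply, Pi.sup_apply]
  cases y i <;> cases z i <;> simp [add_comm]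

theorem map_add_eq_of_add_eq {E : Type*} [AddCommGroup E] [Module ℝ E] (f : E →ᵃ[ℝ] ℝ)
    {p q r s : E} (h : p + q = r + s) : f p + f q = f r + f s := by
  have := congrArg f.linear h
  rw [f.decomp]
  simp only [map_add, Pi.add_apply] at this ⊢
  linarith

/-- Each kind of non-edge contradicts an affine relation between vertex positions: two incomparable
cube vertices by submodularity, a pair involving a cross-polytope vertex because `M` is too high for
the values that the cube allows. -/
theorem compatible_of_touching {d : ℕ} {M : ℝ} (f : (Fin d → ℝ) →ᵃ[ℝ] ℝ) {W : ℝ}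
    (hW : ∀ y : Fin d → Bool, cubeHeight y ≤ W) (hM : d * W + W < M)
    (hf : ∀ y, f (position d (Sum.inr y)) ≤ cubeHeight y) {S : Finset (Vertex d)}
    (hcross : ∀ b, Sum.inl b ∈ S → f (position d (Sum.inl b)) = M)
    (hcube : ∀ y, Sum.inr y ∈ S → f (position d (Sum.inr y)) = cubeHeight y) :
    ∀ u ∈ S, ∀ v ∈ S, Compatible u v := by
  have hW0 : 0 ≤ W := (cubeHeight_nonneg fun _ => true).trans (hW _)
  have hdW : 0 ≤ d * W := by positivity
  -- The origin is the midpoint of two opposite cube vertices.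
  have hf0 : f 0 ≤ W := by
    have : f 0 + f 0 = f (position d (Sum.inr fun _ => true)) +
        f (position d (Sum.inr fun _ => false)) := by
      refine map_add_eq_of_add_eq f ?_
      funext i
      simp [position, sgn, neg_div]
    linarith [hf fun _ => true, hf fun _ => false, hW fun _ => true, hW fun _ => false]
  have hcc : ∀ (a : Fin d × Bool) (y : Fin d → Bool), Sum.inl a ∈ S → Sum.inr y ∈ S →
      y a.1 = a.2 := by
    rintro ⟨i, b⟩ y ha hy
    by_contra hne
    have hd : (d : ℝ) ≠ 0 := by
      have := i.pos
      positivity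
    -- Flipping the wrong sign moves a cube vertex by `1 / d` towards `± eᵢ`, so `d` such steps from
    -- the origin reach the cross-polytope vertex.
    have hpos : position d (Sum.inl (i, b)) = (d : ℝ) •
        (position d (Sum.inr (Function.update y i b)) - position d (Sum.inr y)) := by
      funext j
      rcases eq_or_ne j i with rfl | hji
      · simp only [position, Pi.single_eq_same, Pi.smul_apply, Pi.sub_apply, Function.update_self,
          smul_eq_mul]
        cases hyj : y j <;> cases b <;> simp_all [sgn] <;> field_simp <;> norm_num
      · simp [position, hji]
    have h1 : f (position d (Sum.inl (i, b))) = d * (f (position d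
        (Sum.inr (Function.update y i b))) - f (position d (Sum.inr y))) + f 0 := by
      rw [hpos, f.decomp]
      simp
    have h2 : f (position d (Sum.inr (Function.update y i b))) - f (position d (Sum.inr y)) ≤ W := by
      rw [hcube y hy]
      linarith [hf (Function.update y i b), hW (Function.update y i b), cubeHeight_nonneg y]
    have h3 := mul_le_mul_of_nonneg_left h2 (Nat.cast_nonneg (α := ℝ) d)
    rw [hcross _ ha] at h1
    linarith
  rintro (⟨i, b⟩ | y) hu (⟨j, c⟩ | z) hv
  · rintro (rfl : i = j)
    by_contra hbc
    have h1 : f (position d (Sum.inl (i, b))) + f (position d (Sum.inl (i, c))) = f 0 + f 0 := by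
      refine map_add_eq_of_add_eq f ?_
      simp only [position, ← Pi.single_add]
      cases b <;> cases c <;> simp_all [sgn]
    rw [hcross _ hu, hcross _ hv] at h1
    linarith
  · exact hcc _ _ hu hv
  · exact hcc _ _ hv hu
  · by_contra h
    simp only [Compatible, not_or] at h
    have h1 := cubeHeight_inf_add_sup_lt h.1 h.2
    have h2 := map_add_eq_of_add_eq f (position_inf_add_sup y z)
    rw [hcube _ hu, hcube _ hv] at h2
    linarith [hf (y ⊓ z), hf (y ⊔ z)]

theorem isProperFace_crossPart {d : ℕ} {S : Finset (Vertex d)} (hS : S ∈ (staircase d).faces) :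
    IsProperFace (crossPart S) := by
  rintro i ⟨h1, h2⟩
  have := hS.2 _ (mem_crossPart.1 h1) _ (mem_crossPart.1 h2) rfl
  cases this

theorem staircase_isRegularTriangulation {d : ℕ} (hd : 0 < d) :
    (staircase d).IsRegularTriangulation (position d) := by
  classical
  choose g hg using fun τ : {τ : Finset (Fin d → Bool) // IsBoolChain τ} =>
    exists_affineMap_touching hd τ.2
  obtain ⟨W, hW⟩ := (Set.finite_range (cubeHeight (d := d))).bddAbove
  have hW : ∀ y : Fin d → Bool, cubeHeight y ≤ W := fun y => hW ⟨y, rfl⟩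
  obtain ⟨M₁, hM₁⟩ := (Set.finite_range fun x : {τ : Finset (Fin d → Bool) // IsBoolChain τ} ×
    (Fin d × Bool) => g x.1 (position d (Sum.inl x.2))).bddAbove
  have hM₁ : ∀ τ b, g τ (position d (Sum.inl b)) ≤ M₁ := fun τ b => hM₁ ⟨(τ, b), rfl⟩
  -- There are finitely many chains, so one height exceeds all values needed for tilting as well as
  -- the bound that excludes non-edges.
  set M : ℝ := max M₁ (d * W + W) + 1 with hM
  have hMlt : d * W + W < M := by linarith [le_max_right M₁ (d * W + W)]
  have hgM : ∀ τ b, g τ (position d (Sum.inl b)) < M := fun τ b => by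
    linarith [le_max_left M₁ (d * W + W), hM₁ τ b]
  let ω : Vertex d → ℝ := Sum.elim (fun _ => M) cubeHeight
  have hex : ∀ S ∈ (staircase d).faces, ∃ f : (Fin d → ℝ) →ᵃ[ℝ] ℝ,
      (∀ v, f (position d v) ≤ ω v) ∧ ∀ v, f (position d v) = ω v ↔ v ∈ S := by
    intro S hS
    obtain ⟨f, hf1, hf2⟩ := exists_tilt hd (isProperFace_crossPart hS)
      (g ⟨cubePart S, isBoolChain_cubePart hS⟩) (hgM _)
    have hg := hg ⟨cubePart S, isBoolChain_cubePart hS⟩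
    refine ⟨f, ?_, ?_⟩
    · rintro (b | y)
      · exact (hf1 b).1
      · exact (hf2 y).1.trans (hg y).1
    · rintro (b | y)
      · exact (hf1 b).2.trans mem_crossPart
      · refine Iff.trans ⟨fun h => ?_, fun h => ?_⟩ mem_cubePart
        · exact (hg y).2.1 (le_antisymm (hg y).1 (h.symm.le.trans (hf2 y).1))
        · refine ((hf2 y).2.1 fun a ha => ?_).trans ((hg y).2.2 h)
          exact hS.2 (Sum.inl a) (mem_crossPart.1 ha) (Sum.inr y) (mem_cubePart.1 h)
  refine ⟨⟨ω, fun S => ⟨fun hS => ⟨hS.1, hex S hS⟩, ?_⟩⟩, fun S hS => ?_⟩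
  · rintro ⟨hne, f, hf, hfS⟩
    exact ⟨hne, compatible_of_touching f hW hMlt (fun y => hf (Sum.inr y))
      (fun b hb => (hfS (Sum.inl b)).2 hb) fun y hy => (hfS (Sum.inr y)).2 hy⟩
  · refine affineIndependent_of_exists_affineMap fun v hv => ?_
    -- Supporting functions of `S` and of `S.erase v` agree on `S.erase v` but not at `v`, so their
    -- difference isolates `v`.
    by_cases hne : (S.erase v).Nonempty
    · obtain ⟨f, -, hf⟩ := hex S hS
      obtain ⟨f', -, hf'⟩ := hex (S.erase v)
        (((staircase d).isRelLowerSet_faces hS).2 (Finset.erase_subset v S) hne)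
      refine ⟨f - f', fun h => ?_, fun u hu huv => ?_⟩
      · refine Finset.notMem_erase v S ((hf' v).1 ?_)
        rw [AffineMap.coe_sub, Pi.sub_apply, (hf v).2 hv] at h
        linarith
      · rw [AffineMap.coe_sub, Pi.sub_apply, (hf u).2 hu,
          (hf' u).2 (Finset.mem_erase.2 ⟨huv, hu⟩), sub_self]
    · refine ⟨AffineMap.const ℝ _ 1, by simp, fun u hu huv => ?_⟩
      exact absurd ⟨u, Finset.mem_erase.2 ⟨huv, hu⟩⟩ hne

theorem staircase_isRegularAntiprismTriangulation {d : ℕ} (hd : 0 < d) :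
    IsRegularAntiprismTriangulation (staircase d) := by
  refine ⟨staircase_isRegularTriangulation hd, fun S hS =>
    ⟨crossPart S, isProperFace_crossPart hS, ?_⟩⟩
  rintro (a | y) hv
  · exact Or.inl ⟨a, mem_crossPart.2 hv, rfl⟩
  · exact Or.inr ⟨y, fun a ha => hS.2 (Sum.inl a) (mem_crossPart.1 ha) (Sum.inr y) hv, rfl⟩

end Antiprism

namespace Antiprism

/-! ### The facets of the quotient complex -/

/-- The facet of the quotient complex that comes from the new simplex spanned by the stacking
vertex, the cube vertex `s` and all vertices but the `i`-th one of the boundary facet `s`. -/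
def stackFacet {d : ℕ} (s : Fin d → Bool) (i : Fin d) : Finset (Fin (d + 1) ⊕ (Fin d → Bool)) :=
  insert (Sum.inr s) ((Finset.univ.erase i.castSucc).image Sum.inl)

/-- The facet of the quotient complex whose cube vertices are the stages `m, …, n` of `π`. -/
def chainFacet {d : ℕ} (π : Equiv.Perm (Fin d)) (m n : ℕ) :
    Finset (Fin (d + 1) ⊕ (Fin d → Bool)) :=
  ((Finset.univ.filter fun i : Fin d => (π i : ℕ) < m ∨ n ≤ (π i : ℕ)).image
    fun i => Sum.inl i.castSucc) ∪ (Finset.Icc m n).image fun k => Sum.inr (stage π k)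

/-- The facets of the quotient complex. -/
def sigmaFacets (d : ℕ) : Set (Finset (Fin (d + 1) ⊕ (Fin d → Bool))) :=
  {F | (∃ s i, s ≠ (fun _ => true) ∧ F = stackFacet s i) ∨
    ∃ π m n, m ≤ n ∧ n ≤ d ∧ (m = n → n = d) ∧ F = chainFacet π m n}

theorem stackFacet_mem {d : ℕ} {s : Fin d → Bool} (hs : s ≠ fun _ => true) (i : Fin d) :
    stackFacet s i ∈ sigmaFacets d := Or.inl ⟨s, i, hs, rfl⟩

theorem chainFacet_mem {d : ℕ} (π : Equiv.Perm (Fin d)) {m n : ℕ} (hmn : m ≤ n) (hn : n ≤ d)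
    (h : m = n → n = d) : chainFacet π m n ∈ sigmaFacets d :=
  Or.inr ⟨π, m, n, hmn, hn, h, rfl⟩

section

variable {d : ℕ} {s y : Fin d → Bool} {i j : Fin d} {π π' : Equiv.Perm (Fin d)} {m n k : ℕ}

@[simp] theorem inl_mem_stackFacet {l : Fin (d + 1)} :
    Sum.inl l ∈ stackFacet s i ↔ l ≠ i.castSucc := by simp [stackFacet]

@[simp] theorem inr_mem_stackFacet : Sum.inr y ∈ stackFacet s i ↔ y = s := by simp [stackFacet]

@[simp] theorem last_notMem_chainFacet : Sum.inl (Fin.last d) ∉ chainFacet π m n := by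
  simp [chainFacet, Fin.castSucc_ne_last]

@[simp] theorem inl_mem_chainFacet :
    Sum.inl i.castSucc ∈ chainFacet π m n ↔ (π i : ℕ) < m ∨ n ≤ (π i : ℕ) := by
  simp [chainFacet]

@[simp] theorem inr_mem_chainFacet :
    Sum.inr y ∈ chainFacet π m n ↔ ∃ k, m ≤ k ∧ k ≤ n ∧ y = stage π k := by
  simp [chainFacet, and_assoc, eq_comm]

theorem stage_injOn {l : ℕ} (hk : k ≤ d) (hl : l ≤ d) (h : stage π k = stage π' l) : k = l := by
  rw [← rank_stage π hk, h, rank_stage π' hl]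

theorem stage_eq_top_iff (hk : k ≤ d) : stage π k = (fun _ => true) ↔ k = d := by
  have h : stage π d = fun _ => true := by
    funext i
    rw [stage_eq_true]
    exact (π i).2
  exact ⟨fun hk' => stage_injOn (π := π) (π' := π) hk le_rfl (hk'.trans h.symm), fun h' => h' ▸ h⟩

theorem top_mem_chainFacet_iff (hmn : m ≤ n) (hn : n ≤ d) :
    Sum.inr (fun _ => true) ∈ chainFacet π m n ↔ n = d := by
  rw [inr_mem_chainFacet]
  constructor
  · rintro ⟨k, -, hk, h⟩
    have := (stage_eq_top_iff (hk.trans hn)).1 h.symm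
    omega
  · rintro rfl
    exact ⟨n, hmn, le_rfl, ((stage_eq_top_iff le_rfl).2 rfl).symm⟩

theorem stage_mem_chainFacet (hk : k ≤ d) (hn : n ≤ d)
    (h : Sum.inr (stage π k) ∈ chainFacet π' m n) : m ≤ k ∧ k ≤ n ∧ stage π k = stage π' k := by
  obtain ⟨l, hl, hl', h⟩ := inr_mem_chainFacet.1 h
  obtain rfl := stage_injOn hk (hl'.trans hn) h
  exact ⟨hl, hl', h⟩

/-- The labels are the coordinates on which stages `m` and `n` agree, so the stages alone determine
the facet. -/
theorem chainFacet_congr (hmn : m ≤ n) (h : ∀ k, m ≤ k → k ≤ n → stage π k = stage π' k) :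
    chainFacet π m n = chainFacet π' m n := by
  ext x
  rcases x with l | y
  · induction l using Fin.lastCases with
    | last => simp
    | cast i =>
      have h1 := congrFun (h m le_rfl hmn) i
      have h2 := congrFun (h n hmn le_rfl) i
      rw [Bool.eq_iff_iff, stage_eq_true, stage_eq_true] at h1 h2
      rw [inl_mem_chainFacet, inl_mem_chainFacet]
      omega
  · rw [inr_mem_chainFacet, inr_mem_chainFacet]
    refine exists_congr fun k => and_congr_right fun hk => and_congr_right fun hk' => ?_
    rw [h k hk hk']

/-- The number of cube vertices in a set of vertices of the quotient. -/
def cubeCard (F : Finset (Fin (d + 1) ⊕ (Fin d → Bool))) : ℕ :=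
  (Finset.univ.filter fun y : Fin d → Bool => Sum.inr y ∈ F).card

/-- The number of the other vertices in a set of vertices of the quotient. -/
def labelCard (F : Finset (Fin (d + 1) ⊕ (Fin d → Bool))) : ℕ :=
  (Finset.univ.filter fun l : Fin (d + 1) => Sum.inl l ∈ F).card

theorem labelCard_add_cubeCard (F : Finset (Fin (d + 1) ⊕ (Fin d → Bool))) :
    labelCard F + cubeCard F = F.card := by
  rw [labelCard, cubeCard, ← Finset.card_disjSum]
  congr 1
  ext (l | y) <;> simp

theorem cubeCard_chainFacet (hmn : m ≤ n) (hn : n ≤ d) :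
    cubeCard (chainFacet π m n) = n - m + 1 := by
  have : (Finset.univ.filter fun y : Fin d → Bool => Sum.inr y ∈ chainFacet π m n) =
      (Finset.Icc m n).image (stage π) := by
    ext y
    simp [and_assoc, eq_comm]
  rw [cubeCard, this, Finset.card_image_of_injOn, Nat.card_Icc]
  · omega
  · intro k hk l hl h
    rw [Finset.coe_Icc, Set.mem_Icc] at hk hl
    exact stage_injOn (hk.2.trans hn) (hl.2.trans hn) h

theorem card_stackFacet : (stackFacet s i).card = d + 1 := by
  rw [stackFacet, Finset.card_insert_of_notMem (by simp),
    Finset.card_image_of_injective _ Sum.inl_injective, Finset.card_erase_of_mem (Finset.mem_univ _)]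
  simp

theorem card_filter_perm_lt (π : Equiv.Perm (Fin d)) (hn : n ≤ d) :
    (Finset.univ.filter fun i : Fin d => (π i : ℕ) < n).card = n := by
  have := rank_stage π hn
  simpa only [rank, stage_eq_true] using this

theorem labelCard_chainFacet (hmn : m ≤ n) (hn : n ≤ d) :
    labelCard (chainFacet π m n) = m + (d - n) := by
  have h1 : (Finset.univ.filter fun l : Fin (d + 1) => Sum.inl l ∈ chainFacet π m n) =
      (Finset.univ.filter fun i : Fin d => (π i : ℕ) < m ∨ n ≤ (π i : ℕ)).map
        Fin.castSuccEmb := by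
    ext l
    induction l using Fin.lastCases with
    | last => simp [Fin.castSucc_ne_last]
    | cast i => simp
  rw [labelCard, h1, Finset.card_map, Finset.filter_or, Finset.card_union_of_disjoint,
    card_filter_perm_lt π (hmn.trans hn)]
  · have h2 := Finset.card_filter_add_card_filter_not (s := (Finset.univ : Finset (Fin d)))
      (fun i => (π i : ℕ) < n)
    rw [card_filter_perm_lt π hn, Finset.card_univ, Fintype.card_fin] at h2
    simp only [not_lt] at h2
    omega
  · rw [Finset.disjoint_filter]
    intro i _ h
    omega

theorem card_of_mem_sigmaFacets {F : Finset (Fin (d + 1) ⊕ (Fin d → Bool))}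
    (hF : F ∈ sigmaFacets d) : F.card = d + 1 := by
  rcases hF with ⟨s, i, -, rfl⟩ | ⟨π, m, n, hmn, hn, -, rfl⟩
  · exact card_stackFacet
  · rw [← labelCard_add_cubeCard, labelCard_chainFacet hmn hn, cubeCard_chainFacet hmn hn]
    omega

/-! ### Neighbouring facets -/

/-- A set of labels and cube vertices without the stacking vertex lies in a facet of the quotient
as soon as it satisfies the evident necessary conditions. -/
theorem exists_facet_superset {G : Finset (Fin (d + 1) ⊕ (Fin d → Bool))}
    (hlast : Sum.inl (Fin.last d) ∉ G)
    (hchain : ∀ y z, Sum.inr y ∈ G → Sum.inr z ∈ G → y ≤ z ∨ z ≤ y)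
    (hconst : ∀ (i : Fin d) y z, Sum.inl i.castSucc ∈ G → Sum.inr y ∈ G → Sum.inr z ∈ G →
      y i = z i)
    (hfull : ∀ y, Sum.inr y ∈ G → (∀ i : Fin d, Sum.inl i.castSucc ∈ G) → y = fun _ => true) :
    ∃ F ∈ sigmaFacets d, G ⊆ F := by
  set τ : Finset (Fin d → Bool) := Finset.univ.filter fun y => Sum.inr y ∈ G with hτ
  have hmem : ∀ y, y ∈ τ ↔ Sum.inr y ∈ G := fun y => by simp [hτ]
  rcases τ.eq_empty_or_nonempty with hemp | hne
  · refine ⟨chainFacet 1 d d, chainFacet_mem _ le_rfl le_rfl fun _ => rfl, ?_⟩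
    rintro (l | y) hx
    · induction l using Fin.lastCases with
      | last => exact absurd hx hlast
      | cast i => rw [inl_mem_chainFacet]; exact Or.inl ((1 : Equiv.Perm (Fin d)) i).2
    · have := (hmem y).2 hx
      rw [hemp] at this
      exact absurd this (Finset.notMem_empty y)
  · obtain ⟨π, hπ⟩ := IsBoolChain.exists_perm (τ := τ) fun y hy z hz =>
      hchain y z ((hmem y).1 hy) ((hmem z).1 hz)
    obtain ⟨a, ha, hamin⟩ := τ.exists_min_image rank hne
    obtain ⟨b, hb, hbmax⟩ := τ.exists_max_image rank hne
    have hab := hamin b hb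
    by_cases h : rank a = rank b → rank b = d
    · refine ⟨chainFacet π (rank a) (rank b), chainFacet_mem _ hab (rank_le b) h, ?_⟩
      rintro (l | y) hx
      · induction l using Fin.lastCases with
        | last => exact absurd hx hlast
        | cast i =>
          have := hconst i a b hx ((hmem a).1 ha) ((hmem b).1 hb)
          rw [hπ a ha, hπ b hb, Bool.eq_iff_iff, stage_eq_true, stage_eq_true] at this
          rw [inl_mem_chainFacet]
          omega
      · have hy := (hmem y).2 hx
        exact inr_mem_chainFacet.2 ⟨rank y, hamin y hy, hbmax y hy, hπ y hy⟩
    -- There is a single cube vertex and it is not top. The simplex over its boundary facet was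
    -- stacked away, so a missing label is needed to fit into a `stackFacet`.
    · push Not at h
      have hone : ∀ y ∈ τ, y = a := fun y hy => by
        have h1 := hamin y hy
        have h2 := hbmax y hy
        rw [hπ y hy, hπ a ha, show rank y = rank a by omega]
      have htop : a ≠ fun _ => true := by
        rw [hπ a ha]
        intro h'
        have := (stage_eq_top_iff (rank_le a)).1 h'
        omega
      obtain ⟨i, hi⟩ : ∃ i : Fin d, Sum.inl i.castSucc ∉ G := by
        by_contra hcon
        push Not at hcon
        exact htop (hfull a ((hmem a).1 ha) hcon)
      refine ⟨stackFacet a i, stackFacet_mem htop i, ?_⟩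
      rintro (l | y) hx
      · rw [inl_mem_stackFacet]
        rintro rfl
        exact hi hx
      · exact inr_mem_stackFacet.2 (hone y ((hmem y).2 hx))

theorem stage_succ_eq_true {k : Fin d} :
    stage π (k + 1) j = true ↔ stage π k j = true ∨ j = π.symm k := by
  rw [stage_eq_true, stage_eq_true, Equiv.eq_symm_apply, Fin.ext_iff]
  omega

/-- The sum of the positions of the positive signs. -/
def weight (y : Fin d → Bool) : ℕ := ∑ i with y i = true, (i : ℕ)

theorem weight_stage_succ (π : Equiv.Perm (Fin d)) (k : Fin d) :
    weight (stage π (k + 1)) = weight (stage π k) + (π.symm k : ℕ) := by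
  have : (Finset.univ.filter fun i => stage π (k + 1) i = true) =
      insert (π.symm k) (Finset.univ.filter fun i => stage π k i = true) := by
    ext i
    simp only [Finset.mem_filter, Finset.mem_univ, true_and, Finset.mem_insert, stage_succ_eq_true]
    exact or_comm
  rw [weight, this, Finset.sum_insert (by simp [stage_eq_true]), weight, add_comm]

/-- Exchanging two consecutive steps of a chain changes one stage. -/
theorem exists_swap (π : Equiv.Perm (Fin d)) {k l : Fin d} (hkl : (l : ℕ) = k + 1) :
    ∃ π' : Equiv.Perm (Fin d), (∀ j : ℕ, j ≠ l → stage π' j = stage π j) ∧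
      stage π' l ≠ stage π l ∧ weight (stage π' l) + π.symm k = weight (stage π l) + π.symm l := by
  have hne : k ≠ l := fun h => by rw [h] at hkl; omega
  have hstage : ∀ j : ℕ, j ≠ l → stage (π.trans (Equiv.swap k l)) j = stage π j := by
    intro j hj
    funext i
    rw [Bool.eq_iff_iff, stage_eq_true, stage_eq_true, Equiv.trans_apply, Equiv.swap_apply_def]
    split_ifs with h1 h2
    · rw [h1]; omega
    · rw [h2]; omega
    · rfl
  refine ⟨π.trans (Equiv.swap k l), hstage, fun h => ?_, ?_⟩
  · have := congrFun h (π.symm k)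
    rw [Bool.eq_iff_iff, stage_eq_true, stage_eq_true, Equiv.trans_apply,
      Equiv.apply_symm_apply, Equiv.swap_apply_left] at this
    omega
  · rw [hkl, weight_stage_succ, weight_stage_succ, hstage k (by omega)]
    simp only [Equiv.symm_trans_apply, Equiv.symm_swap, Equiv.swap_apply_left]
    omega

/-- The labels depend only on the two end stages, which `π` and `π'` share. -/
theorem erase_stage_subset_of_eq (hm : m ≠ k) (hn : n ≠ k)
    (h : ∀ j : ℕ, j ≠ k → stage π' j = stage π j) :
    (chainFacet π m n).erase (Sum.inr (stage π k)) ⊆ chainFacet π' m n := by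
  rintro (l | y) hx
  · have hx := Finset.mem_of_mem_erase hx
    induction l using Fin.lastCases with
    | last => exact absurd hx last_notMem_chainFacet
    | cast i =>
      have h1 := congrFun (h m hm) i
      have h2 := congrFun (h n hn) i
      rw [Bool.eq_iff_iff, stage_eq_true, stage_eq_true] at h1 h2
      rw [inl_mem_chainFacet] at hx ⊢
      omega
  · obtain ⟨hne, hx⟩ := Finset.mem_erase.1 hx
    obtain ⟨l, hml, hln, rfl⟩ := inr_mem_chainFacet.1 hx
    refine inr_mem_chainFacet.2 ⟨l, hml, hln, (h l ?_).symm⟩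
    rintro rfl
    exact hne rfl

/-- The facet opposite to a label in a chain facet contains a new cube vertex. -/
theorem exists_facet_erase_label (hi : (π i : ℕ) < m ∨ n ≤ (π i : ℕ)) :
    ∃ F ∈ sigmaFacets d, (chainFacet π m n).erase (Sum.inl i.castSucc) ⊆ F ∧
      ∃ w, Sum.inr w ∈ F ∧ Sum.inr w ∉ chainFacet π m n := by
  -- Giving up the label `i` allows coordinate `i` to vary: the chain is extended below its first
  -- stage by making `i` negative, or above its last stage by making `i` positive.
  obtain ⟨w, hw, hwc, hwo⟩ : ∃ w : Fin d → Bool, w ∉ Set.range (fun k : Set.Icc m n => stage π k) ∧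
      (∀ k, m ≤ k → k ≤ n → w ≤ stage π k ∨ stage π k ≤ w) ∧
      ∀ j, j ≠ i → (π j : ℕ) < m ∨ n ≤ (π j : ℕ) → ∀ k, m ≤ k → k ≤ n → w j = stage π k j := by
    rcases hi with hi | hi
    · refine ⟨Function.update (stage π m) i false, ?_, fun k hk _ => Or.inl ?_,
        fun j hji hj k hk hkn => ?_⟩
      · rintro ⟨⟨k, hk⟩, h⟩
        have := congrFun h i
        simp only [Function.update_self, stage_eq_false] at this
        have := hk.1
        omega
      · refine le_trans ?_ (stage_mono π hk)
        rw [update_le_iff]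
        exact ⟨Bool.false_le _, fun _ _ => le_rfl⟩
      · rw [Function.update_of_ne hji, Bool.eq_iff_iff, stage_eq_true, stage_eq_true]
        omega
    · refine ⟨Function.update (stage π n) i true, ?_, fun k _ hk => Or.inr ?_,
        fun j hji hj k hk hkn => ?_⟩
      · rintro ⟨⟨k, hk⟩, h⟩
        have := congrFun h i
        simp only [Function.update_self, stage_eq_true] at this
        have := hk.2
        omega
      · refine le_trans (stage_mono π hk) ?_
        rw [le_update_iff]
        exact ⟨Bool.le_true _, fun _ _ => le_rfl⟩
      · rw [Function.update_of_ne hji, Bool.eq_iff_iff, stage_eq_true, stage_eq_true]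
        omega
  have hmemr : ∀ y, Sum.inr y ∈ insert (Sum.inr w) ((chainFacet π m n).erase
      (Sum.inl i.castSucc)) → y = w ∨ ∃ k, m ≤ k ∧ k ≤ n ∧ y = stage π k := by
    intro y hy
    rw [Finset.mem_insert, Finset.mem_erase, inr_mem_chainFacet] at hy
    rcases hy with hy | hy
    · exact Or.inl (Sum.inr_injective hy)
    · exact Or.inr hy.2
  have hmeml : ∀ j : Fin d, Sum.inl j.castSucc ∈ insert (Sum.inr w) ((chainFacet π m n).erase
      (Sum.inl i.castSucc)) → j ≠ i ∧ ((π j : ℕ) < m ∨ n ≤ (π j : ℕ)) := by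
    intro j hj
    rw [Finset.mem_insert, Finset.mem_erase, inl_mem_chainFacet] at hj
    rcases hj with hj | hj
    · cases hj
    · exact ⟨fun h => hj.1 (by rw [h]), hj.2⟩
  obtain ⟨F, hF, hsub⟩ := exists_facet_superset
    (G := insert (Sum.inr w) ((chainFacet π m n).erase (Sum.inl i.castSucc))) (by simp) (by
      intro y z hy hz
      rcases hmemr y hy with rfl | ⟨k, hk, hk', rfl⟩ <;>
        rcases hmemr z hz with rfl | ⟨l, hl, hl', rfl⟩
      · exact Or.inl le_rfl
      · exact hwc l hl hl'
      · exact (hwc k hk hk').symm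
      · exact (le_total k l).imp (stage_mono π) (stage_mono π)) (by
      intro j y z hj hy hz
      obtain ⟨hji, hj⟩ := hmeml j hj
      have key : ∀ y, Sum.inr y ∈ insert (Sum.inr w) ((chainFacet π m n).erase
          (Sum.inl i.castSucc)) → y j = w j := by
        intro y hy
        rcases hmemr y hy with rfl | ⟨k, hk, hk', rfl⟩
        · rfl
        · exact (hwo j hji hj k hk hk').symm
      rw [key y hy, key z hz]) (fun y _ h => absurd rfl (hmeml i (h i)).1)
  refine ⟨F, hF, (Finset.subset_insert _ _).trans hsub, w, hsub (Finset.mem_insert_self _ _), ?_⟩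
  intro h
  obtain ⟨k, hk, hk', rfl⟩ := inr_mem_chainFacet.1 h
  exact hw ⟨⟨k, hk, hk'⟩, rfl⟩

theorem erase_first_subset :
    (chainFacet π m n).erase (Sum.inr (stage π m)) ⊆ chainFacet π (m + 1) n := by
  rintro (l | y) hx
  · have hx := Finset.mem_of_mem_erase hx
    induction l using Fin.lastCases with
    | last => exact absurd hx last_notMem_chainFacet
    | cast i => rw [inl_mem_chainFacet] at hx ⊢; omega
  · obtain ⟨hne, hx⟩ := Finset.mem_erase.1 hx
    obtain ⟨l, hml, hln, rfl⟩ := inr_mem_chainFacet.1 hx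
    refine inr_mem_chainFacet.2 ⟨l, lt_of_le_of_ne hml ?_, hln, rfl⟩
    rintro rfl
    exact hne rfl

theorem erase_last_subset :
    (chainFacet π m (n + 1)).erase (Sum.inr (stage π (n + 1))) ⊆ chainFacet π m n := by
  rintro (l | y) hx
  · have hx := Finset.mem_of_mem_erase hx
    induction l using Fin.lastCases with
    | last => exact absurd hx last_notMem_chainFacet
    | cast i => rw [inl_mem_chainFacet] at hx ⊢; omega
  · obtain ⟨hne, hx⟩ := Finset.mem_erase.1 hx
    obtain ⟨l, hml, hln, rfl⟩ := inr_mem_chainFacet.1 hx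
    refine inr_mem_chainFacet.2 ⟨l, hml, Nat.lt_succ_iff.1 (lt_of_le_of_ne hln ?_), rfl⟩
    rintro rfl
    exact hne rfl

/-- Shortening a two-stage chain would leave one cube vertex over a full boundary facet, a simplex
that is stacked unless that vertex is top. The index `2 * m + 1 - k` is the one of `m`, `m + 1`
other than `k`. -/
theorem erase_edge_subset (hm : m < d) (hk : k = m ∨ k = m + 1) :
    ((chainFacet π m (m + 1)).erase (Sum.inr (stage π k))) ⊆
      stackFacet (stage π (2 * m + 1 - k)) (π.symm ⟨m, hm⟩) := by
  rintro (l | y) hx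
  · have hx := Finset.mem_of_mem_erase hx
    rw [inl_mem_stackFacet]
    rintro rfl
    rw [inl_mem_chainFacet, Equiv.apply_symm_apply] at hx
    simp at hx
  · obtain ⟨hne, hx⟩ := Finset.mem_erase.1 hx
    obtain ⟨l, hml, hln, rfl⟩ := inr_mem_chainFacet.1 hx
    have : l ≠ k := by rintro rfl; exact hne rfl
    rw [inr_mem_stackFacet, show l = 2 * m + 1 - k by omega]

end

end Antiprism

namespace Antiprism

section

variable {d : ℕ} {s y : Fin d → Bool} {i j : Fin d} {π π' : Equiv.Perm (Fin d)} {m n k : ℕ}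
  {F F' : Finset (Fin (d + 1) ⊕ (Fin d → Bool))}

/-! ### The order of the facets -/

open Classical in
/-- The numbers by which the facets of the quotient are ordered lexicographically: first the facets
at the stacking vertex, then the others without the top cube vertex (by increasing number of cube
vertices), then those with it (by decreasing number of cube vertices). Chains with the same ends are
compared by their first difference. -/
noncomputable def keyFun (F : Finset (Fin (d + 1) ⊕ (Fin d → Bool))) : ℕ → ℕ
  | 0 => if Sum.inl (Fin.last d) ∈ F then 0 else if Sum.inr (fun _ => true) ∈ F then 2 else 1
  | 1 => if Sum.inl (Fin.last d) ∈ F then (if Sum.inr (fun _ => false) ∈ F then 0 else 1)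
      else if Sum.inr (fun _ => true) ∈ F then labelCard F else cubeCard F
  | k + 2 => if Sum.inl (Fin.last d) ∈ F then ∑ l with Sum.inl l ∈ F, (l : ℕ)
      else ∑ y with Sum.inr y ∈ F ∧ rank y = k, weight y

/-- The key by which the facets of the quotient are ordered. -/
noncomputable def key (F : Finset (Fin (d + 1) ⊕ (Fin d → Bool))) : Lex (ℕ → ℕ) := toLex (keyFun F)

theorem key_lt_of_first_lt (h : ∀ l < k, keyFun F l = keyFun F' l) (hk : keyFun F k < keyFun F' k) :
    key F < key F' := ⟨k, h, hk⟩

theorem key_lt_of_zero_lt (h : keyFun F 0 < keyFun F' 0) : key F < key F' :=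
  key_lt_of_first_lt (fun _ hl => absurd hl (Nat.not_lt_zero _)) h

theorem key_lt_of_one_lt (h0 : keyFun F 0 = keyFun F' 0) (h : keyFun F 1 < keyFun F' 1) :
    key F < key F' :=
  key_lt_of_first_lt (k := 1) (fun l hl => by obtain rfl : l = 0 := Nat.lt_one_iff.1 hl; exact h0) h

theorem keyFun_zero_le (h : key F ≤ key F') : keyFun F 0 ≤ keyFun F' 0 :=
  Pi.apply_le_of_toLex h fun _ hl => absurd hl (Nat.not_lt_zero _)

theorem keyFun_one_le (h : key F ≤ key F') (h0 : keyFun F 0 = keyFun F' 0) :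
    keyFun F 1 ≤ keyFun F' 1 :=
  Pi.apply_le_of_toLex h fun l hl => by obtain rfl : l = 0 := Nat.lt_one_iff.1 hl; exact h0

theorem last_mem_stackFacet : Sum.inl (Fin.last d) ∈ stackFacet s i := by
  simp [(Fin.castSucc_ne_last i).symm]

theorem keyFun_zero_stackFacet : keyFun (stackFacet s i) 0 = 0 := by
  rw [keyFun, if_pos last_mem_stackFacet]

open Classical in
theorem keyFun_one_stackFacet :
    keyFun (stackFacet s i) 1 = if s = fun _ => false then 0 else 1 := by
  rw [keyFun, if_pos last_mem_stackFacet]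
  simp [eq_comm]

/-- The label sum determines the missing label, so it separates the facets at a fixed cube vertex.
-/
theorem keyFun_two_stackFacet : keyFun (stackFacet s i) 2 + i = ∑ l : Fin (d + 1), (l : ℕ) := by
  rw [keyFun, if_pos last_mem_stackFacet]
  simp only [inl_mem_stackFacet]
  rw [Finset.filter_ne', ← Finset.sum_erase_add _ _ (Finset.mem_univ i.castSucc)]
  rfl

theorem keyFun_zero_chainFacet (hmn : m ≤ n) (hn : n ≤ d) :
    keyFun (chainFacet π m n) 0 = if n = d then 2 else 1 := by
  rw [keyFun, if_neg last_notMem_chainFacet]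
  simp only [top_mem_chainFacet_iff hmn hn]

theorem keyFun_one_chainFacet (hmn : m ≤ n) (hn : n ≤ d) :
    keyFun (chainFacet π m n) 1 = if n = d then m else n - m + 1 := by
  rw [keyFun, if_neg last_notMem_chainFacet]
  simp only [top_mem_chainFacet_iff hmn hn, labelCard_chainFacet hmn hn,
    cubeCard_chainFacet hmn hn]
  split_ifs <;> omega

theorem keyFun_add_two_chainFacet (hn : n ≤ d) :
    keyFun (chainFacet π m n) (k + 2) = if m ≤ k ∧ k ≤ n then weight (stage π k) else 0 := by
  rw [keyFun, if_neg last_notMem_chainFacet]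
  have : (Finset.univ.filter fun y : Fin d → Bool => Sum.inr y ∈ chainFacet π m n ∧ rank y = k) =
      if m ≤ k ∧ k ≤ n then {stage π k} else ∅ := by
    ext y
    rw [Finset.mem_filter, inr_mem_chainFacet]
    split_ifs with h
    · rw [Finset.mem_singleton]
      constructor
      · rintro ⟨-, ⟨l, hl, hl', rfl⟩, hr⟩
        rw [rank_stage π (hl'.trans hn)] at hr
        rw [hr]
      · rintro rfl
        exact ⟨Finset.mem_univ _, ⟨k, h.1, h.2, rfl⟩, rank_stage π (h.2.trans hn)⟩
    · simp only [Finset.notMem_empty, iff_false]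
      rintro ⟨-, ⟨l, hl, hl', rfl⟩, hr⟩
      rw [rank_stage π (hl'.trans hn)] at hr
      omega
  rw [this]
  split_ifs <;> simp

/-! ### Earlier facets across prescribed ridges -/

theorem exists_eq_chainFacet_of_top_mem (hF : F ∈ sigmaFacets d) (h : Sum.inr (fun _ => true) ∈ F) :
    ∃ π m, m ≤ d ∧ F = chainFacet π m d := by
  rcases hF with ⟨s, i, hs, rfl⟩ | ⟨π, m, n, hmn, hn, -, rfl⟩
  · exact absurd (inr_mem_stackFacet.1 h).symm hs
  · obtain rfl := (top_mem_chainFacet_iff hmn hn).1 h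
    exact ⟨π, m, hmn, rfl⟩

theorem stage_ne_top (hk : k < d) : stage π k ≠ fun _ => true := fun h =>
  hk.ne ((stage_eq_top_iff hk.le).1 h)

/-- The first stage is traded for a label, or for the stacking vertex if a single non-top stage
remains. The key comparison is limited to `n < d`, because facets containing top are ordered by
increasing number of labels and the trade leads to a later one. -/
theorem exists_facet_erase_first (hmn : m < n) (hn : n ≤ d) :
    ∃ F ∈ sigmaFacets d, (chainFacet π m n).erase (Sum.inr (stage π m)) ⊆ F ∧
      (∃ x ∈ F, x ∉ chainFacet π m n) ∧ (n < d → key F < key (chainFacet π m n)) := by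
  by_cases h : m + 1 = n ∧ n < d
  · obtain ⟨rfl, hn'⟩ := h
    refine ⟨_, stackFacet_mem ?_ (π.symm ⟨m, by omega⟩), erase_edge_subset (by omega) (Or.inl rfl),
      ⟨_, last_mem_stackFacet, last_notMem_chainFacet⟩, fun _ => key_lt_of_zero_lt ?_⟩
    · exact stage_ne_top (by omega)
    · rw [keyFun_zero_stackFacet, keyFun_zero_chainFacet hmn.le hn]
      split_ifs <;> norm_num
  · refine ⟨_, chainFacet_mem π (m := m + 1) hmn hn (by omega), erase_first_subset,
      ⟨Sum.inl (π.symm ⟨m, by omega⟩).castSucc, ?_, ?_⟩, fun hn' => key_lt_of_one_lt ?_ ?_⟩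
    · rw [inl_mem_chainFacet, Equiv.apply_symm_apply]
      exact Or.inl (Nat.lt_succ_self m)
    · rw [inl_mem_chainFacet, Equiv.apply_symm_apply, Fin.val_mk]
      omega
    · rw [keyFun_zero_chainFacet hmn hn, keyFun_zero_chainFacet hmn.le hn]
    · rw [keyFun_one_chainFacet hmn hn, keyFun_one_chainFacet hmn.le hn, if_neg hn'.ne,
        if_neg hn'.ne]
      omega

/-- Shortening at the upper end always goes to an earlier facet: it reaches the stacking vertex, or
removes top, or reduces the number of cube vertices of a chain without top. -/
theorem exists_facet_erase_last (hmn : m < n) (hn : n ≤ d) :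
    ∃ F ∈ sigmaFacets d, (chainFacet π m n).erase (Sum.inr (stage π n)) ⊆ F ∧
      (∃ x ∈ F, x ∉ chainFacet π m n) ∧ key F < key (chainFacet π m n) := by
  obtain ⟨n, rfl⟩ : ∃ l, n = l + 1 := ⟨n - 1, by omega⟩
  by_cases h : m = n
  · subst h
    have hsub := erase_edge_subset (π := π) (d := d) (m := m) (k := m + 1) (by omega) (Or.inr rfl)
    rw [show 2 * m + 1 - (m + 1) = m by omega] at hsub
    refine ⟨_, stackFacet_mem ?_ (π.symm ⟨m, by omega⟩), hsub,
      ⟨_, last_mem_stackFacet, last_notMem_chainFacet⟩, key_lt_of_zero_lt ?_⟩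
    · exact stage_ne_top (by omega)
    · rw [keyFun_zero_stackFacet, keyFun_zero_chainFacet hmn.le hn]
      split_ifs <;> norm_num
  · have hmn' : m ≤ n := Nat.lt_succ_iff.1 hmn
    refine ⟨_, chainFacet_mem π (n := n) hmn' (by omega) (by omega), erase_last_subset,
      ⟨Sum.inl (π.symm ⟨n, by omega⟩).castSucc, ?_, ?_⟩, ?_⟩
    · rw [inl_mem_chainFacet, Equiv.apply_symm_apply]
      exact Or.inr le_rfl
    · rw [inl_mem_chainFacet, Equiv.apply_symm_apply, Fin.val_mk]
      omega
    · rcases eq_or_lt_of_le hn with h' | h'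
      · refine key_lt_of_zero_lt ?_
        rw [keyFun_zero_chainFacet hmn' (by omega), keyFun_zero_chainFacet hmn.le hn, if_pos h',
          if_neg (by omega)]
        norm_num
      · refine key_lt_of_one_lt ?_ ?_
        · rw [keyFun_zero_chainFacet hmn' (by omega), keyFun_zero_chainFacet hmn.le hn, if_neg h'.ne,
            if_neg (by omega)]
        · rw [keyFun_one_chainFacet hmn' (by omega), keyFun_one_chainFacet hmn.le hn, if_neg h'.ne,
            if_neg (by omega)]
          omega

/-- If two chains with the same ends differ, and the first difference is in favour of the second
one, then the first one has a descent at a stage that is not a stage of the second one. -/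
theorem exists_descent (hmn : m ≤ n) (hn : n ≤ d) (hm' : stage π m = stage π' m)
    (hn' : stage π n = stage π' n) (hne : ∃ k, m ≤ k ∧ k ≤ n ∧ stage π k ≠ stage π' k)
    (hle : ∀ k, m ≤ k → k ≤ n → (∀ l, m ≤ l → l < k → stage π l = stage π' l) →
      weight (stage π' k) ≤ weight (stage π k)) :
    ∃ k l : Fin d, (l : ℕ) = k + 1 ∧ m < l ∧ (l : ℕ) < n ∧ π.symm l < π.symm k ∧
      stage π l ≠ stage π' l := by
  classical
  obtain ⟨hmp, hpn, hp⟩ := Nat.find_spec hne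
  have hmin : ∀ l, m ≤ l → l < Nat.find hne → stage π l = stage π' l := fun l hl hlp => by
    by_contra h
    exact Nat.find_min hne hlp ⟨hl, by omega, h⟩
  have hw := hle _ hmp hpn hmin
  generalize Nat.find hne = p at *
  have hpm : p ≠ m := by rintro rfl; exact hp hm'
  have hpn' : p ≠ n := by rintro rfl; exact hp hn'
  obtain ⟨q, rfl⟩ : ∃ q, p = q + 1 := ⟨p - 1, by omega⟩
  have hqd : q < d := by omega
  have hq := hmin q (by omega) (Nat.lt_succ_self q)
  have h1 := weight_stage_succ π ⟨q, hqd⟩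
  have h2 := weight_stage_succ π' ⟨q, hqd⟩
  simp only at h1 h2
  rw [h1, h2, hq] at hw
  set a := π.symm ⟨q, hqd⟩ with ha
  set b := π'.symm ⟨q, hqd⟩ with hb
  have hab : a ≠ b := by
    intro hab
    apply hp
    funext j
    have h3 := stage_succ_eq_true (π := π) (k := ⟨q, hqd⟩) (j := j)
    have h4 := stage_succ_eq_true (π := π') (k := ⟨q, hqd⟩) (j := j)
    simp only at h3 h4
    rw [Bool.eq_iff_iff, h3, h4, hq, ← ha, ← hb, hab]
  have hba : b < a := by
    rcases lt_trichotomy a b with h | h | h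
    · have : (a : ℕ) < b := h
      omega
    · exact absurd h hab
    · exact h
  have hπ'b : π' b = ⟨q, hqd⟩ := by rw [hb, Equiv.apply_symm_apply]
  -- The coordinate `b`, which `π'` adds at step `q`, is added by `π` at a later step, still before
  -- stage `n`.
  have hπb : q < π b := by
    have h3 : stage π q b = false := by
      rw [hq, stage_eq_false, hπ'b]
    rw [stage_eq_false] at h3
    refine lt_of_le_of_ne h3 fun h => hab ?_
    rw [ha, Equiv.symm_apply_eq]
    exact Fin.ext h
  have hπbn : (π b : ℕ) < n := by
    rw [← stage_eq_true, hn', stage_eq_true, hπ'b]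
    simp only
    omega
  by_contra hcon
  push Not at hcon
  -- Until `π` adds `b`, its stages after `q` lack `b` while those of `π'` contain it. So a descent
  -- there would be as required; without one the added coordinates never fall below `a`,
  -- contradicting `b < a`.
  have hmono : ∀ l, q ≤ l → ∀ hl : l < d, l ≤ π b → a ≤ π.symm ⟨l, hl⟩ := by
    intro l hl
    induction l, hl using Nat.le_induction with
    | base => exact fun _ _ => le_rfl
    | succ l hl ih =>
      intro hl' hlb
      refine (ih (by omega) (by omega)).trans ?_
      by_contra hlt
      have h3 := hcon ⟨l, by omega⟩ ⟨l + 1, hl'⟩ rfl (by simp only; omega) (by simp only; omega)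
        (not_le.1 hlt)
      have h4 := congrFun h3 b
      rw [Bool.eq_iff_iff, stage_eq_true, stage_eq_true, hπ'b] at h4
      simp only at h4
      omega
  have := hmono (π b) hπb.le (π b).2 le_rfl
  simp only [Fin.eta, Equiv.symm_apply_apply] at this
  exact absurd hba (not_lt.2 this)

/-- The keys agree up to the first differing stage, so the smaller key adds the smaller coordinate
there. This gives a descent of `π` at a stage missing from the other chain; exchanging its two steps
lowers the weight of that stage and changes no other. -/
theorem exists_earlier_of_same_ends (hmn : m ≤ n) (hn : n ≤ d) (hmn' : m = n → n = d)
    (hm' : stage π m = stage π' m) (hn' : stage π n = stage π' n)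
    (hne : chainFacet π' m n ≠ chainFacet π m n)
    (hkey : key (chainFacet π' m n) ≤ key (chainFacet π m n)) :
    ∃ v ∈ chainFacet π m n, v ∉ chainFacet π' m n ∧
      ∃ F ∈ sigmaFacets d, (chainFacet π m n).erase v ⊆ F ∧ key F < key (chainFacet π m n) := by
  have key_agree : ∀ {π π' : Equiv.Perm (Fin d)} (k : ℕ),
      (∀ l, m ≤ l → l < k → stage π' l = stage π l) →
      ∀ l < k + 2, keyFun (chainFacet π' m n) l = keyFun (chainFacet π m n) l := by
    intro π π' k h l hl
    match l with
    | 0 => rw [keyFun_zero_chainFacet hmn hn, keyFun_zero_chainFacet hmn hn]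
    | 1 => rw [keyFun_one_chainFacet hmn hn, keyFun_one_chainFacet hmn hn]
    | l + 2 =>
      rw [keyFun_add_two_chainFacet hn, keyFun_add_two_chainFacet hn]
      split_ifs with hl'
      · rw [h l hl'.1 (by omega)]
      · rfl
  obtain ⟨k, l, hkl, hml, hln, hlt, hstage⟩ := exists_descent hmn hn hm' hn' (by
    by_contra hcon
    push Not at hcon
    exact hne (chainFacet_congr hmn fun k hk hk' => (hcon k hk hk').symm)) (by
    intro k hk hk' hagree
    have := Pi.apply_le_of_toLex hkey (i := k + 2)
      (key_agree k fun l hl hlk => (hagree l hl hlk).symm)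
    rwa [keyFun_add_two_chainFacet hn, keyFun_add_two_chainFacet hn, if_pos ⟨hk, hk'⟩,
      if_pos ⟨hk, hk'⟩] at this)
  obtain ⟨π'', h1, -, h3⟩ := exists_swap π hkl
  refine ⟨Sum.inr (stage π l), inr_mem_chainFacet.2 ⟨l, hml.le, hln.le, rfl⟩, fun h => ?_,
    chainFacet π'' m n, chainFacet_mem π'' hmn hn hmn',
    erase_stage_subset_of_eq hml.ne hln.ne' h1, ?_⟩
  · exact hstage (stage_mem_chainFacet l.2.le hn h).2.2
  · refine key_lt_of_first_lt (k := l + 2) (key_agree l fun j _ hj => h1 j hj.ne) ?_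
    rw [keyFun_add_two_chainFacet hn, keyFun_add_two_chainFacet hn, if_pos ⟨hml.le, hln.le⟩,
      if_pos ⟨hml.le, hln.le⟩]
    have : (π.symm l : ℕ) < π.symm k := hlt
    omega

theorem inl_mem_chainFacet_top : Sum.inl i.castSucc ∈ chainFacet π m d ↔ (π i : ℕ) < m := by
  rw [inl_mem_chainFacet]
  have := (π i).2
  omega

/-- A chain ending at top has exactly as many labels as the index of its first stage, namely the
positive coordinates of that stage. Containment against the inequality of sizes forces equality. -/
theorem mem_chainFacet_top_of_le {π π' : Equiv.Perm (Fin d)} {m m' : ℕ} (hm : m ≤ d) (hm' : m' ≤ d)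
    (hle : m' ≤ m)
    (hsub : ∀ i : Fin d, Sum.inl i.castSucc ∈ chainFacet π m d →
      Sum.inl i.castSucc ∈ chainFacet π' m' d) :
    m' = m ∧ stage π m = stage π' m := by
  simp only [inl_mem_chainFacet_top] at hsub
  have hss : (Finset.univ.filter fun i : Fin d => (π i : ℕ) < m) ⊆
      Finset.univ.filter fun i : Fin d => (π' i : ℕ) < m' := fun i hi =>
    Finset.mem_filter.2 ⟨Finset.mem_univ i, hsub i (Finset.mem_filter.1 hi).2⟩
  have heq := Finset.eq_of_subset_of_card_le hss
    (by rwa [card_filter_perm_lt π hm, card_filter_perm_lt π' hm'])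
  have hmm : m' = m := by
    rw [← card_filter_perm_lt π hm, heq, card_filter_perm_lt π' hm']
  refine ⟨hmm, ?_⟩
  subst hmm
  funext i
  rw [Bool.eq_iff_iff, stage_eq_true, stage_eq_true]
  simpa using Finset.ext_iff.1 heq i

/-- At the same cube vertex, the earlier facet itself contains the ridge opposite to the label it
misses. At different cube vertices, the ridge opposite to `s` also lies in the facet at the
all-negative vector, which comes first. -/
theorem exists_earlier_stackFacet (hs : s ≠ fun _ => true) (hF' : F' ∈ sigmaFacets d)
    (hne : F' ≠ stackFacet s i) (hkey : key F' ≤ key (stackFacet s i)) :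
    ∃ v ∈ stackFacet s i, v ∉ F' ∧
      ∃ F'' ∈ sigmaFacets d, (stackFacet s i).erase v ⊆ F'' ∧ key F'' < key (stackFacet s i) := by
  have h0 := keyFun_zero_le hkey
  rw [keyFun_zero_stackFacet] at h0
  rcases hF' with ⟨s', i', hs', rfl⟩ | ⟨π, m, n, hmn, hn, -, rfl⟩
  · rcases eq_or_ne s' s with rfl | hss
    · have hi : i' ≠ i := by rintro rfl; exact hne rfl
      refine ⟨Sum.inl i'.castSucc, by simpa using hi, by simp, _, stackFacet_mem hs' i', ?_, ?_⟩
      · rintro (l | y) hx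
        · rw [Finset.mem_erase] at hx
          rw [inl_mem_stackFacet]
          rintro rfl
          exact hx.1 rfl
        · rw [Finset.mem_erase, inr_mem_stackFacet] at hx
          exact inr_mem_stackFacet.2 hx.2
      · refine lt_of_le_of_ne hkey fun h => hi ?_
        have h1 : keyFun (stackFacet s' i') 2 = keyFun (stackFacet s' i) 2 := congrFun h 2
        have h2 := keyFun_two_stackFacet (s := s') (i := i)
        rw [← keyFun_two_stackFacet (s := s') (i := i')] at h2
        exact Fin.ext (by omega)
    · refine ⟨Sum.inr s, by simp, by simpa using hss.symm, stackFacet (fun _ => false) i,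
        stackFacet_mem (fun h => ?_) i, ?_, key_lt_of_one_lt ?_ ?_⟩
      · have := congrFun h i
        cases this
      · rintro (l | y) hx
        · have := Finset.mem_of_mem_erase hx
          rw [inl_mem_stackFacet] at this ⊢
          exact this
        · rw [Finset.mem_erase, inr_mem_stackFacet] at hx
          exact absurd (congrArg Sum.inr hx.2) hx.1
      · rw [keyFun_zero_stackFacet, keyFun_zero_stackFacet]
      · have h1 := keyFun_one_le hkey (by rw [keyFun_zero_stackFacet, keyFun_zero_stackFacet])
        rw [keyFun_one_stackFacet, keyFun_one_stackFacet] at h1 ⊢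
        rw [if_pos rfl]
        split_ifs at h1 ⊢ with h2 h3 <;> simp_all
  · rw [keyFun_zero_chainFacet hmn hn] at h0
    split_ifs at h0 <;> omega

/-- An earlier facet missing an end of the chain is handled by shortening there. One containing both
ends has at least as many cube vertices, so the key forces the same ends. -/
theorem exists_earlier_chainFacet_of_lt (hmn : m < n) (hn : n < d) (hF' : F' ∈ sigmaFacets d)
    (hne : F' ≠ chainFacet π m n) (hkey : key F' ≤ key (chainFacet π m n)) :
    ∃ v ∈ chainFacet π m n, v ∉ F' ∧
      ∃ F'' ∈ sigmaFacets d, (chainFacet π m n).erase v ⊆ F'' ∧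
        key F'' < key (chainFacet π m n) := by
  by_cases hm' : Sum.inr (stage π m) ∈ F'
  swap
  · obtain ⟨F'', hF'', hsub, -, hlt⟩ := exists_facet_erase_first (π := π) hmn hn.le
    exact ⟨_, inr_mem_chainFacet.2 ⟨m, le_rfl, hmn.le, rfl⟩, hm', F'', hF'', hsub, hlt hn⟩
  by_cases hn' : Sum.inr (stage π n) ∈ F'
  swap
  · obtain ⟨F'', hF'', hsub, -, hlt⟩ := exists_facet_erase_last (π := π) hmn hn.le
    exact ⟨_, inr_mem_chainFacet.2 ⟨n, hmn.le, le_rfl, rfl⟩, hn', F'', hF'', hsub, hlt⟩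
  rcases hF' with ⟨s', i', hs', rfl⟩ | ⟨π', m', n', hmn', hnd', -, rfl⟩
  · rw [inr_mem_stackFacet] at hm' hn'
    exact absurd (stage_injOn (hmn.le.trans hn.le) hn.le (hm'.trans hn'.symm)) hmn.ne
  · obtain ⟨h1, h2, h3⟩ := stage_mem_chainFacet (hmn.le.trans hn.le) hnd' hm'
    obtain ⟨h4, h5, h6⟩ := stage_mem_chainFacet hn.le hnd' hn'
    have h0 := keyFun_zero_le hkey
    rw [keyFun_zero_chainFacet hmn.le hn.le, keyFun_zero_chainFacet hmn' hnd', if_neg hn.ne] at h0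
    have hnd : n' ≠ d := by
      rintro rfl
      rw [if_pos rfl] at h0
      omega
    have h7 := keyFun_one_le hkey (by rw [keyFun_zero_chainFacet hmn.le hn.le,
      keyFun_zero_chainFacet hmn' hnd', if_neg hn.ne, if_neg hnd])
    rw [keyFun_one_chainFacet hmn.le hn.le, keyFun_one_chainFacet hmn' hnd', if_neg hn.ne,
      if_neg hnd] at h7
    obtain rfl : m = m' := by omega
    obtain rfl : n = n' := by omega
    exact exists_earlier_of_same_ends hmn.le hn.le (fun h => absurd h hmn.ne) h3 h6 hne hkey

/-- The neighbour keeps all cube vertices, including top, and gains one. Among facets containing top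
this means an earlier position. -/
theorem exists_earlier_erase_label (hm : m ≤ d) (hi : (π i : ℕ) < m) :
    ∃ F ∈ sigmaFacets d, (chainFacet π m d).erase (Sum.inl i.castSucc) ⊆ F ∧
      key F < key (chainFacet π m d) := by
  obtain ⟨F, hF, hsub, w, hwF, hw⟩ := exists_facet_erase_label (n := d) (Or.inl hi)
  refine ⟨F, hF, hsub, ?_⟩
  obtain ⟨π', m', hm', rfl⟩ := exists_eq_chainFacet_of_top_mem hF (hsub (Finset.mem_erase.2
    ⟨by simp, (top_mem_chainFacet_iff hm le_rfl).2 rfl⟩))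
  refine key_lt_of_one_lt (by rw [keyFun_zero_chainFacet hm le_rfl,
    keyFun_zero_chainFacet hm' le_rfl]) ?_
  rw [keyFun_one_chainFacet hm le_rfl, keyFun_one_chainFacet hm' le_rfl, if_pos rfl, if_pos rfl]
  have hlt : cubeCard (chainFacet π m d) < cubeCard (chainFacet π' m' d) := by
    refine Finset.card_lt_card ⟨fun y hy => ?_, fun h => ?_⟩
    · exact Finset.mem_filter.2 ⟨Finset.mem_univ y,
        hsub (Finset.mem_erase.2 ⟨by simp, (Finset.mem_filter.1 hy).2⟩)⟩
    · exact hw (Finset.mem_filter.1 (h (Finset.mem_filter.2 ⟨Finset.mem_univ w, hwF⟩))).2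
  rw [cubeCard_chainFacet hm le_rfl, cubeCard_chainFacet hm' le_rfl] at hlt
  omega

/-- A missing label is exchanged for a cube vertex. If no label is missing, either top is missing
and can be dropped, or counting labels forces the first stages to coincide as well. For `m = d`, all
`d` labels occur, which is impossible in a facet without top. -/
theorem exists_earlier_chainFacet_top (hm : m ≤ d) (hF' : F' ∈ sigmaFacets d)
    (hne : F' ≠ chainFacet π m d) (hkey : key F' ≤ key (chainFacet π m d)) :
    ∃ v ∈ chainFacet π m d, v ∉ F' ∧
      ∃ F'' ∈ sigmaFacets d, (chainFacet π m d).erase v ⊆ F'' ∧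
        key F'' < key (chainFacet π m d) := by
  by_cases hlab : ∀ i : Fin d, Sum.inl i.castSucc ∈ chainFacet π m d → Sum.inl i.castSucc ∈ F'
  swap
  · push Not at hlab
    obtain ⟨i, hi, hi'⟩ := hlab
    obtain ⟨F'', h1, h2, h3⟩ := exists_earlier_erase_label hm (inl_mem_chainFacet_top.1 hi)
    exact ⟨_, hi, hi', F'', h1, h2, h3⟩
  have htopstage : stage π d = fun _ => true := (stage_eq_top_iff le_rfl).2 rfl
  by_cases htop : Sum.inr (fun _ => true) ∈ F'
  · obtain ⟨π', m', hm', rfl⟩ := exists_eq_chainFacet_of_top_mem hF' htop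
    have h1 := keyFun_one_le hkey (by rw [keyFun_zero_chainFacet hm le_rfl,
      keyFun_zero_chainFacet hm' le_rfl])
    rw [keyFun_one_chainFacet hm le_rfl, keyFun_one_chainFacet hm' le_rfl, if_pos rfl,
      if_pos rfl] at h1
    obtain ⟨rfl, h2⟩ := mem_chainFacet_top_of_le hm hm' h1 hlab
    exact exists_earlier_of_same_ends hm le_rfl (fun _ => rfl) h2
      (by rw [htopstage, (stage_eq_top_iff le_rfl).2 rfl]) hne hkey
  · rcases eq_or_lt_of_le hm with rfl | hlt
    · rcases hF' with ⟨s', i', hs', rfl⟩ | ⟨π', m', n', hmn', hnd', hmn'', rfl⟩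
      · have := hlab i' (inl_mem_chainFacet_top.2 (π i').2)
        simp at this
      · have hn'' : n' ≠ m := fun h => htop ((top_mem_chainFacet_iff hmn' hnd').2 h)
        have hm'' : m' < n' := lt_of_le_of_ne hmn' fun h => hn'' (hmn'' h)
        have := hlab (π'.symm ⟨m', by omega⟩) (inl_mem_chainFacet_top.2 (Fin.is_lt _))
        rw [inl_mem_chainFacet, Equiv.apply_symm_apply, Fin.val_mk] at this
        omega
    · obtain ⟨F'', hF'', hsub, -, hlt'⟩ := exists_facet_erase_last (π := π) hlt le_rfl
      rw [htopstage] at hsub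
      exact ⟨_, (top_mem_chainFacet_iff hm le_rfl).2 rfl, htop, F'', hF'', hsub, hlt'⟩

theorem exists_earlier_ridge (hF : F ∈ sigmaFacets d) (hF' : F' ∈ sigmaFacets d) (hne : F' ≠ F)
    (hkey : key F' ≤ key F) :
    ∃ v ∈ F, v ∉ F' ∧ ∃ F'' ∈ sigmaFacets d, F.erase v ⊆ F'' ∧ key F'' < key F := by
  rcases hF with ⟨s, i, hs, rfl⟩ | ⟨π, m, n, hmn, hn, hmn', rfl⟩
  · exact exists_earlier_stackFacet hs hF' hne hkey
  · rcases eq_or_lt_of_le hn with rfl | hlt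
    · exact exists_earlier_chainFacet_top hmn hF' hne hkey
    · exact exists_earlier_chainFacet_of_lt (lt_of_le_of_ne hmn fun h => hlt.ne (hmn' h)) hlt hF'
        hne hkey

/-- Every facet of the quotient has a ridge that is in no earlier facet. -/
theorem exists_new_ridge (hF : F ∈ sigmaFacets d) :
    ∃ v ∈ F, ∀ F' ∈ sigmaFacets d, F.erase v ⊆ F' → ¬ key F' < key F := by
  rcases hF with ⟨s, i, hs, rfl⟩ | ⟨π, m, n, hmn, hn, hmn', rfl⟩
  -- Without the stacking vertex, the ridge still shows `s` and the missing label, so it fixes the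
  -- facet among those at the stacking vertex.
  · refine ⟨_, last_mem_stackFacet, fun F' hF' hsub hlt => ?_⟩
    have h0 := keyFun_zero_le hlt.le
    rw [keyFun_zero_stackFacet] at h0
    rcases hF' with ⟨s', i', hs', rfl⟩ | ⟨π', m', n', hmn', hnd', -, rfl⟩
    · have h1 : s = s' := inr_mem_stackFacet.1 (hsub (Finset.mem_erase.2 ⟨by simp, by simp⟩))
      have h2 : i' = i := by
        by_contra h
        have : Sum.inl i'.castSucc ∈ stackFacet s' i' :=
          hsub (Finset.mem_erase.2 ⟨by simp [Fin.castSucc_ne_last], by simpa using h⟩)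
        simp at this
      rw [h1, h2] at hlt
      exact lt_irrefl _ hlt
    · rw [keyFun_zero_chainFacet hmn' hnd'] at h0
      split_ifs at h0 <;> omega
  · rcases eq_or_lt_of_le hn with rfl | hnd
    -- The first stage is removed: the remaining labels are its positive coordinates, so no facet
    -- with a smaller key can replace it. For `m = n` this ridge is the unstacked boundary facet.
    · refine ⟨Sum.inr (stage π m), inr_mem_chainFacet.2 ⟨m, le_rfl, hmn, rfl⟩,
        fun F' hF' hsub hlt => ?_⟩
      have hlab : ∀ i : Fin n, Sum.inl i.castSucc ∈ chainFacet π m n → Sum.inl i.castSucc ∈ F' :=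
        fun i hi => hsub (Finset.mem_erase.2 ⟨by simp, hi⟩)
      obtain ⟨π', m', hm', rfl⟩ : ∃ π' m', m' ≤ n ∧ F' = chainFacet π' m' n := by
        rcases eq_or_lt_of_le hmn with rfl | hmn1
        · rcases hF' with ⟨s', i', hs', rfl⟩ | ⟨π', m', n', hmn2, hnd', hmn'', rfl⟩
          · have := hlab i' (inl_mem_chainFacet_top.2 (π i').2)
            simp at this
          · rcases eq_or_lt_of_le hmn2 with h | h
            · obtain rfl := hmn'' h
              exact ⟨π', m', hmn2, rfl⟩
            · have := hlab (π'.symm ⟨m', by omega⟩) (inl_mem_chainFacet_top.2 (Fin.is_lt _))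
              rw [inl_mem_chainFacet, Equiv.apply_symm_apply, Fin.val_mk] at this
              omega
        · refine exists_eq_chainFacet_of_top_mem hF' (hsub (Finset.mem_erase.2
            ⟨fun h => ?_, (top_mem_chainFacet_iff hmn hn).2 rfl⟩))
          exact stage_ne_top hmn1 (Sum.inr_injective h).symm
      have h1 := keyFun_one_le hlt.le (by rw [keyFun_zero_chainFacet hmn le_rfl,
        keyFun_zero_chainFacet hm' le_rfl])
      rw [keyFun_one_chainFacet hmn le_rfl, keyFun_one_chainFacet hm' le_rfl, if_pos rfl,
        if_pos rfl] at h1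
      obtain ⟨rfl, h2⟩ := mem_chainFacet_top_of_le hmn hm' h1 hlab
      refine hlt.ne (congrArg key (chainFacet_congr hmn fun k hk hkn => ?_))
      rcases eq_or_lt_of_le hk with rfl | hk
      · exact h2.symm
      · refine (stage_mem_chainFacet (π := π) hkn le_rfl (hsub (Finset.mem_erase.2
          ⟨fun h => ?_, inr_mem_chainFacet.2 ⟨k, hk.le, hkn, rfl⟩⟩))).2.2.symm
        exact hk.ne' (stage_injOn hkn hmn (Sum.inr_injective h))
    · have hmn1 : m < n := lt_of_le_of_ne hmn fun h => hnd.ne (hmn' h)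
      -- Removing a label keeps all stages, and an earlier facet has no room for a further one. As
      -- `n < d`, there is a label at position `n`.
      refine ⟨Sum.inl (π.symm ⟨n, hnd⟩).castSucc, ?_, fun F' hF' hsub hlt => ?_⟩
      · rw [inl_mem_chainFacet, Equiv.apply_symm_apply]
        exact Or.inr le_rfl
      have hstage : ∀ k, m ≤ k → k ≤ n → Sum.inr (stage π k) ∈ F' := fun k hk hkn =>
        hsub (Finset.mem_erase.2 ⟨by simp, inr_mem_chainFacet.2 ⟨k, hk, hkn, rfl⟩⟩)
      have h0 := keyFun_zero_le hlt.le
      rw [keyFun_zero_chainFacet hmn hn, if_neg hnd.ne] at h0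
      rcases hF' with ⟨s', i', hs', rfl⟩ | ⟨π', m', n', hmn2, hnd', hmn'', rfl⟩
      · have h1 := inr_mem_stackFacet.1 (hstage m le_rfl hmn)
        have h2 := inr_mem_stackFacet.1 (hstage n hmn le_rfl)
        exact hmn1.ne (stage_injOn (hmn.trans hn) hn (h1.trans h2.symm))
      · rw [keyFun_zero_chainFacet hmn2 hnd'] at h0
        have hnd2 : n' ≠ d := by
          rintro rfl
          rw [if_pos rfl] at h0
          omega
        have h7 := keyFun_one_le hlt.le (by rw [keyFun_zero_chainFacet hmn hn,
          keyFun_zero_chainFacet hmn2 hnd', if_neg hnd.ne, if_neg hnd2])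
        rw [keyFun_one_chainFacet hmn hn, keyFun_one_chainFacet hmn2 hnd', if_neg hnd.ne,
          if_neg hnd2] at h7
        have h8 := stage_mem_chainFacet (hmn.trans hn) hnd' (hstage m le_rfl hmn)
        have h9 := stage_mem_chainFacet hn hnd' (hstage n hmn le_rfl)
        obtain rfl : m = m' := by omega
        obtain rfl : n = n' := by omega
        exact hlt.ne (congrArg key (chainFacet_congr hmn fun k hk hkn =>
          (stage_mem_chainFacet (hkn.trans hn) hnd' (hstage k hk hkn)).2.2.symm))

/-! ### Ridges -/

/-- The vertices of the boundary facet that has not been stacked. -/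
def baseFace (d : ℕ) : Finset (Fin (d + 1) ⊕ (Fin d → Bool)) :=
  Finset.univ.image fun i : Fin d => Sum.inl i.castSucc

/-- Every ridge other than the unstacked boundary facet is in two facets. -/
theorem exists_ne_facet_of_ridge (hd : 2 ≤ d) (hF : F ∈ sigmaFacets d)
    {v : Fin (d + 1) ⊕ (Fin d → Bool)} (hv : v ∈ F) (hne : F.erase v ≠ baseFace d) :
    ∃ F' ∈ sigmaFacets d, F' ≠ F ∧ F.erase v ⊆ F' := by
  rcases hF with ⟨s, i, hs, rfl⟩ | ⟨π, m, n, hmn, hn, hmn', rfl⟩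
  · rcases v with l | y
    · rw [inl_mem_stackFacet] at hv
      induction l using Fin.lastCases with
      | last =>
        -- Across the ridge opposite to the stacking vertex lies a chain facet: the missing label
        -- `i` allows `s` to be joined to its flip at `i`.
        have hmem : ∀ y, Sum.inr y ∈ insert (Sum.inr (Function.update s i (!s i)))
            ((stackFacet s i).erase (Sum.inl (Fin.last d))) →
            y = Function.update s i (!s i) ∨ y = s := by
          intro y hy
          rw [Finset.mem_insert, Finset.mem_erase, inr_mem_stackFacet] at hy
          exact hy.imp (fun h => Sum.inr_injective h) fun h => h.2
        have hle : s ≤ Function.update s i (!s i) ∨ Function.update s i (!s i) ≤ s := by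
          cases h : s i
          · refine Or.inl (le_update_iff.2 ⟨?_, fun _ _ => le_rfl⟩)
            rw [h]; exact Bool.false_le _
          · refine Or.inr (update_le_iff.2 ⟨?_, fun _ _ => le_rfl⟩)
            exact Bool.false_le _
        have hi : Sum.inl i.castSucc ∉ insert (Sum.inr (Function.update s i (!s i)))
            ((stackFacet s i).erase (Sum.inl (Fin.last d))) := by
          simp
        obtain ⟨F', hF', hsub⟩ := exists_facet_superset (G := insert (Sum.inr
          (Function.update s i (!s i))) ((stackFacet s i).erase (Sum.inl (Fin.last d))))
          (by simp) (by
            intro y z hy hz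
            rcases hmem y hy with rfl | rfl <;> rcases hmem z hz with rfl | rfl
            · exact Or.inl le_rfl
            · exact hle.symm
            · exact hle
            · exact Or.inl le_rfl) (by
            intro j y z hj hy hz
            have hji : j ≠ i := by rintro rfl; exact hi hj
            rcases hmem y hy with rfl | rfl <;> rcases hmem z hz with rfl | rfl <;> simp [hji])
          (fun y _ h => absurd (h i) hi)
        refine ⟨F', hF', ?_, (Finset.subset_insert _ _).trans hsub⟩
        rintro rfl
        have h1 := inr_mem_stackFacet.1 (hsub (Finset.mem_insert_self _ _))
        have h2 := congrFun h1 i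
        simp at h2
      | cast j =>
        have hji : j ≠ i := by rintro rfl; exact hv rfl
        refine ⟨stackFacet s j, stackFacet_mem hs j, fun h => ?_, ?_⟩
        · have : Sum.inl i.castSucc ∈ stackFacet s j := by simpa using hji.symm
          rw [h] at this
          simp at this
        · rintro (l | y) hx
          · rw [inl_mem_stackFacet]
            rintro rfl
            exact (Finset.mem_erase.1 hx).1 rfl
          · exact inr_mem_stackFacet.2 (inr_mem_stackFacet.1 (Finset.mem_of_mem_erase hx))
    · obtain rfl := inr_mem_stackFacet.1 hv
      -- The ridge consists of labels only and lies in a facet for every non-top cube vertex. Here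
      -- `2 ≤ d` guarantees a second one.
      obtain ⟨t, ht, hty⟩ : ∃ t : Fin d → Bool, t ≠ (fun _ => true) ∧ t ≠ y := by
        have hf : (fun _ => false : Fin d → Bool) ≠ fun _ => true := fun h => by
          have := congrFun h i
          cases this
        by_cases h : (fun _ => false) = y
        · refine ⟨Function.update (fun _ => false) i true, fun h' => ?_, fun h' => ?_⟩
          · obtain ⟨j, hj⟩ : ∃ j : Fin d, j ≠ i := by
              have : Nontrivial (Fin d) := Fin.nontrivial_iff_two_le.2 hd
              exact exists_ne i
            have := congrFun h' j
            simp [hj] at this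
          · have := congrFun h' i
            simp [← h] at this
        · exact ⟨_, hf, h⟩
      refine ⟨stackFacet t i, stackFacet_mem ht i, fun h => ?_, ?_⟩
      · have : Sum.inr t ∈ stackFacet t i := by simp
        rw [h] at this
        exact hty (inr_mem_stackFacet.1 this)
      · rintro (l | z) hx
        · exact inl_mem_stackFacet.2 (inl_mem_stackFacet.1 (Finset.mem_of_mem_erase hx))
        · rw [Finset.mem_erase, inr_mem_stackFacet] at hx
          exact absurd (congrArg Sum.inr hx.2) hx.1
  · rcases v with l | y
    · induction l using Fin.lastCases with
      | last => exact absurd hv last_notMem_chainFacet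
      | cast i =>
        obtain ⟨F', hF', hsub, w, hw, hw'⟩ := exists_facet_erase_label (inl_mem_chainFacet.1 hv)
        exact ⟨F', hF', by rintro rfl; exact hw' hw, hsub⟩
    · obtain ⟨k, hmk, hkn, rfl⟩ := inr_mem_chainFacet.1 hv
      rcases eq_or_lt_of_le hmn with rfl | hlt
      -- A one-stage chain has top as its only cube vertex; dropping top gives exactly the excluded
      -- ridge.
      · obtain rfl : m = k := by omega
        obtain rfl := hmn' rfl
        refine absurd ?_ hne
        ext x
        rw [Finset.mem_erase, baseFace]
        rcases x with l | y
        · induction l using Fin.lastCases with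
          | last => simp [Fin.castSucc_ne_last]
          | cast i => simp
        · rw [inr_mem_chainFacet]
          simp only [Finset.mem_image, Finset.mem_univ, true_and, reduceCtorEq, exists_false,
            iff_false]
          rintro ⟨h1, l, hl, hl', rfl⟩
          exact h1 (by rw [show l = m by omega])
      · rcases eq_or_lt_of_le hmk with rfl | hmk
        · obtain ⟨F', hF', hsub, ⟨x, hx, hx'⟩, -⟩ := exists_facet_erase_first (π := π) hlt hn
          exact ⟨F', hF', by rintro rfl; exact hx' hx, hsub⟩
        · rcases eq_or_lt_of_le hkn with rfl | hkn
          · obtain ⟨F', hF', hsub, ⟨x, hx, hx'⟩, -⟩ := exists_facet_erase_last (π := π) hlt hn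
            exact ⟨F', hF', by rintro rfl; exact hx' hx, hsub⟩
          · obtain ⟨π', h1, h2, -⟩ := exists_swap π (k := ⟨k - 1, by omega⟩)
              (l := ⟨k, by omega⟩) (by simp only; omega)
            simp only at h1 h2
            refine ⟨_, chainFacet_mem π' hmn hn hmn', fun h => h2 ?_,
              erase_stage_subset_of_eq hmk.ne hkn.ne' h1⟩
            have : Sum.inr (stage π' k) ∈ chainFacet π' m n :=
              inr_mem_chainFacet.2 ⟨k, hmk.le, hkn.le, rfl⟩
            rw [h] at this
            exact (stage_mem_chainFacet (hkn.le.trans hn) hn this).2.2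

end

end Antiprism

namespace Antiprism

section

variable {d : ℕ} {S S' : Finset (Vertex d ⊕ OtherFacet d)}

/-! ### The identification -/

theorem mem_crossFacet {s : Fin d → Bool} {i : Fin d} {b : Bool} :
    Sum.inl (i, b) ∈ crossFacet s ↔ b = s i := by
  simp [crossFacet, eq_comm]

theorem inr_notMem_crossFacet {s y : Fin d → Bool} : Sum.inr y ∉ crossFacet s := by
  simp [crossFacet]

/-- The pairs of vertices that may occur in a face of the stacked complex. -/
structure IsConsistent (S : Finset (Vertex d ⊕ OtherFacet d)) : Prop where
  cross_cross : ∀ {i b c}, Sum.inl (Sum.inl (i, b)) ∈ S → Sum.inl (Sum.inl (i, c)) ∈ S → b = c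
  cube_cross : ∀ {y i b}, Sum.inl (Sum.inr y) ∈ S → Sum.inl (Sum.inl (i, b)) ∈ S → b = y i
  new_new : ∀ {a b}, Sum.inr a ∈ S → Sum.inr b ∈ S → a = b
  new_cross : ∀ {a : OtherFacet d} {i b}, Sum.inr a ∈ S → Sum.inl (Sum.inl (i, b)) ∈ S → b = a.1 i
  new_cube : ∀ {a : OtherFacet d} {y}, Sum.inr a ∈ S → Sum.inl (Sum.inr y) ∈ S → y = a.1
  not_subset : ∀ a : OtherFacet d, ∃ i, Sum.inl (Sum.inl (i, a.1 i)) ∉ S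

theorem exists_notMem_of_not_subset {G : Finset (Vertex d)} {s : Fin d → Bool}
    (h : ¬ crossFacet s ⊆ G) : ∃ i, Sum.inl (i, s i) ∉ G := by
  obtain ⟨x, hx, hxG⟩ := Finset.not_subset.1 h
  rcases x with ⟨i, b⟩ | y
  · obtain rfl := mem_crossFacet.1 hx
    exact ⟨i, hxG⟩
  · exact absurd hx inr_notMem_crossFacet

theorem isConsistent_of_mem (hS : S ∈ (stacked (staircase d)).faces) : IsConsistent S := by
  rcases hS with ⟨G, hG, hF, rfl⟩ | ⟨a, G, hG, hF, rfl⟩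
  · refine ⟨fun h1 h2 => ?_, fun h1 h2 => ?_, fun h1 => ?_, fun h1 => ?_, fun h1 => ?_,
      fun a => ?_⟩
    · simp only [Finset.mem_image, Sum.inl.injEq, exists_eq_right] at h1 h2
      exact hG.2 _ h1 _ h2 rfl
    · simp only [Finset.mem_image, Sum.inl.injEq, exists_eq_right] at h1 h2
      exact (hG.2 _ h1 _ h2).symm
    · simp at h1
    · simp at h1
    · simp at h1
    · simpa using exists_notMem_of_not_subset (hF a)
  · have hl : ∀ {x : Vertex d}, (Sum.inl x : Vertex d ⊕ OtherFacet d) ∈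
        insert (Sum.inr a) (G.image Sum.inl) ↔ x ∈ G := by simp
    have hr : ∀ {b : OtherFacet d}, Sum.inr b ∈
        insert (Sum.inr a) (G.image Sum.inl) ↔ b = a := by simp
    have hcr : ∀ i, Sum.inl (i, a.1 i) ∈ G ∪ crossFacet a.1 := fun i =>
      Finset.mem_union_right _ (mem_crossFacet.2 rfl)
    refine ⟨fun h1 h2 => ?_, fun h1 h2 => ?_, fun h1 h2 => ?_, fun h1 h2 => ?_, fun h1 h2 => ?_,
      fun a => ?_⟩
    · exact hG.2 _ (Finset.mem_union_left _ (hl.1 h1)) _ (Finset.mem_union_left _ (hl.1 h2)) rfl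
    · exact (hG.2 _ (Finset.mem_union_left _ (hl.1 h1)) _
        (Finset.mem_union_left _ (hl.1 h2))).symm
    · rw [hr.1 h1, hr.1 h2]
    · rw [hr.1 h1]
      exact hG.2 _ (Finset.mem_union_left _ (hl.1 h2)) _ (hcr _) rfl
    · rw [hr.1 h1]
      funext i
      exact hG.2 _ (Finset.mem_union_left _ (hl.1 h2)) _ (hcr i)
    · obtain ⟨i, hi⟩ := exists_notMem_of_not_subset (hF a)
      exact ⟨i, fun h => hi (hl.1 h)⟩

theorem inr_mem_image_identify {y : Fin d → Bool} :
    Sum.inr y ∈ S.image (identify d) ↔ Sum.inl (Sum.inr y) ∈ S := by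
  simp [identify]

theorem last_mem_image_identify :
    Sum.inl (Fin.last d) ∈ S.image (identify d) ↔ ∃ a, Sum.inr a ∈ S := by
  simp only [Finset.mem_image]
  constructor
  · rintro ⟨(⟨i, b⟩ | y) | a, hx, h⟩
    · simp [identify, Fin.castSucc_ne_last] at h
    · simp [identify] at h
    · exact ⟨a, hx⟩
  · rintro ⟨a, ha⟩
    exact ⟨_, ha, rfl⟩

theorem castSucc_mem_image_identify {i : Fin d} :
    Sum.inl i.castSucc ∈ S.image (identify d) ↔ ∃ b, Sum.inl (Sum.inl (i, b)) ∈ S := by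
  simp only [Finset.mem_image]
  constructor
  · rintro ⟨(⟨j, b⟩ | y) | a, hx, h⟩
    · obtain rfl : j = i := by simpa [identify] using h
      exact ⟨b, hx⟩
    · simp [identify] at h
    · simp [identify, (Fin.castSucc_ne_last i).symm] at h
  · rintro ⟨b, hb⟩
    exact ⟨_, hb, rfl⟩

theorem IsConsistent.injOn (hS : IsConsistent S) : Set.InjOn (identify d) S := by
  rintro ((⟨i, b⟩ | y) | a) hx ((⟨j, c⟩ | z) | a') hx' h
  · obtain rfl : i = j := by simpa [identify] using h
    rw [hS.cross_cross hx hx']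
  · simp [identify] at h
  · simp [identify, Fin.castSucc_ne_last] at h
  · simp [identify] at h
  · obtain rfl : y = z := by simpa [identify] using h
    rfl
  · simp [identify] at h
  · simp [identify, (Fin.castSucc_ne_last j).symm] at h
  · simp [identify] at h
  · rw [hS.new_new hx hx']

/-- The common cube vertex prescribes the sign of every cross-polytope vertex and identifies the
stacking vertex, so the lift of each label is unique. -/
theorem IsConsistent.subset_of_image_eq (hS : IsConsistent S) (hS' : IsConsistent S')
    (h : S.image (identify d) = S'.image (identify d)) {y : Fin d → Bool}
    (hy : Sum.inl (Sum.inr y) ∈ S) : S ⊆ S' := by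
  have hy' : Sum.inl (Sum.inr y) ∈ S' := by
    rw [← inr_mem_image_identify, ← h, inr_mem_image_identify]
    exact hy
  rintro ((⟨i, b⟩ | z) | a) hx
  · have : Sum.inl i.castSucc ∈ S.image (identify d) := castSucc_mem_image_identify.2 ⟨b, hx⟩
    rw [h, castSucc_mem_image_identify] at this
    obtain ⟨c, hc⟩ := this
    rw [hS.cube_cross hy hx, ← hS'.cube_cross hy' hc]
    exact hc
  · rw [← inr_mem_image_identify, ← h, inr_mem_image_identify]
    exact hx
  · have : Sum.inl (Fin.last d) ∈ S.image (identify d) := last_mem_image_identify.2 ⟨a, hx⟩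
    rw [h, last_mem_image_identify] at this
    obtain ⟨c, hc⟩ := this
    have : a = c := Subtype.ext ((hS.new_cube hx hy).symm.trans (hS'.new_cube hc hy'))
    rw [this]
    exact hc

theorem IsConsistent.subset_stackedFacet (hS : IsConsistent S)
    (hcube : ∀ y, Sum.inl (Sum.inr y) ∉ S)
    (h : (∃ a, Sum.inr a ∈ S) ∨ ∃ i, ∀ b, Sum.inl (Sum.inl (i, b)) ∉ S) :
    ∃ s, S ⊆ stackedFacet s := by
  have hmem : ∀ {s : OtherFacet d} {i}, Sum.inl (Sum.inl (i, s.1 i)) ∈ stackedFacet s := by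
    intro s i
    simp [stackedFacet, crossFacet]
  by_cases hnew : ∃ a, Sum.inr a ∈ S
  · obtain ⟨a, ha⟩ := hnew
    refine ⟨a, ?_⟩
    rintro ((⟨i, b⟩ | y) | c) hx
    · rw [hS.new_cross ha hx]
      exact hmem
    · exact absurd hx (hcube y)
    · rw [hS.new_new hx ha]
      exact Finset.mem_insert_self _ _
  · obtain ⟨i, hi⟩ := h.resolve_left hnew
    -- Coordinates not used by `S` receive a negative sign. As `i` is unused, the resulting facet
    -- differs from the unstacked one.
    let s : Fin d → Bool := fun j => decide (Sum.inl (Sum.inl (j, true)) ∈ S)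
    have hs : s ≠ fun _ => true := fun hs => by
      have := congrFun hs i
      simp only [s, decide_eq_true_eq] at this
      exact hi true this
    refine ⟨⟨s, hs⟩, ?_⟩
    rintro ((⟨j, b⟩ | y) | c) hx
    · have hb : b = s j := by
        cases b
        · symm
          simp only [s, decide_eq_false_iff_not]
          intro h
          cases hS.cross_cross h hx
        · simp [s, hx]
      rw [hb]
      exact hmem (s := ⟨s, hs⟩)
    · exact absurd hx (hcube y)
    · exact absurd ⟨c, hx⟩ hnew

/-- With all coordinates present, `S` contains a whole boundary facet, and every one but the
all-positive facet was removed by stacking. -/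
theorem IsConsistent.eq_of_full (hS : IsConsistent S) (hcube : ∀ y, Sum.inl (Sum.inr y) ∉ S)
    (hnew : ∀ a, Sum.inr a ∉ S) (hfull : ∀ i, ∃ b, Sum.inl (Sum.inl (i, b)) ∈ S) :
    S = (crossFacet fun _ => true).image Sum.inl := by
  choose s hs using hfull
  have hs' : s = fun _ => true := by
    by_contra h
    obtain ⟨i, hi⟩ := hS.not_subset ⟨s, h⟩
    exact hi (hs i)
  subst hs'
  ext ((⟨i, b⟩ | y) | c)
  · simp only [Finset.mem_image, Sum.inl.injEq, exists_eq_right, mem_crossFacet]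
    exact ⟨fun h => hS.cross_cross h (hs i), by rintro rfl; exact hs i⟩
  · simp [hcube y, crossFacet]
  · simp [hnew c]

theorem staircase_identifiesOnlyStackedFacets : IdentifiesOnlyStackedFacets (staircase d) := by
  refine ⟨fun S hS => (isConsistent_of_mem hS).injOn, fun S hS S' hS' h => ?_⟩
  have hc := isConsistent_of_mem hS
  have hc' := isConsistent_of_mem hS'
  by_cases hy : ∃ y, Sum.inl (Sum.inr y) ∈ S
  · obtain ⟨y, hy⟩ := hy
    have hy' : Sum.inl (Sum.inr y) ∈ S' := by
      rw [← inr_mem_image_identify, ← h, inr_mem_image_identify]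
      exact hy
    exact Or.inl ((hc.subset_of_image_eq hc' h hy).antisymm (hc'.subset_of_image_eq hc h.symm hy'))
  · have hcube : ∀ y, Sum.inl (Sum.inr y) ∉ S := fun y hy' => hy ⟨y, hy'⟩
    have hcube' : ∀ y, Sum.inl (Sum.inr y) ∉ S' := fun y => by
      rw [← inr_mem_image_identify, ← h, inr_mem_image_identify]
      exact hcube y
    have hnew : (∃ a, Sum.inr a ∈ S) ↔ ∃ a, Sum.inr a ∈ S' := by
      rw [← last_mem_image_identify, h, last_mem_image_identify]
    have hfull : ∀ i, (∃ b, Sum.inl (Sum.inl (i, b)) ∈ S) ↔ ∃ b, Sum.inl (Sum.inl (i, b)) ∈ S' := by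
      intro i
      rw [← castSucc_mem_image_identify, h, castSucc_mem_image_identify]
    by_cases hcase : (∃ a, Sum.inr a ∈ S) ∨ ∃ i, ∀ b, Sum.inl (Sum.inl (i, b)) ∉ S
    · refine Or.inr ⟨hc.subset_stackedFacet hcube hcase, hc'.subset_stackedFacet hcube' ?_⟩
      refine hcase.imp hnew.1 fun ⟨i, hi⟩ => ⟨i, fun b hb => ?_⟩
      obtain ⟨c, hc⟩ := (hfull i).2 ⟨b, hb⟩
      exact hi c hc
    · push Not at hcase
      obtain ⟨h1, h2⟩ := hcase
      left
      rw [hc.eq_of_full hcube h1 h2, hc'.eq_of_full hcube' (fun a ha => ?_) fun i => (hfull i).1 (h2 i)]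
      obtain ⟨b, hb⟩ := hnew.2 ⟨a, ha⟩
      exact h1 b hb

/-! ### The quotient -/

theorem exists_facet_superset_image (hS : S ∈ (stacked (staircase d)).faces) :
    ∃ F ∈ sigmaFacets d, S.image (identify d) ⊆ F := by
  have hc := isConsistent_of_mem hS
  by_cases hnew : ∃ a, Sum.inr a ∈ S
  · obtain ⟨a, ha⟩ := hnew
    obtain ⟨i, hi⟩ := hc.not_subset a
    refine ⟨stackFacet a.1 i, stackFacet_mem a.2 i, ?_⟩
    rintro (l | y) hx
    · rw [inl_mem_stackFacet]
      rintro rfl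
      obtain ⟨b, hb⟩ := castSucc_mem_image_identify.1 hx
      exact hi (hc.new_cross ha hb ▸ hb)
    · exact inr_mem_stackFacet.2 (hc.new_cube ha (inr_mem_image_identify.1 hx))
  · refine exists_facet_superset (fun h => hnew (last_mem_image_identify.1 h)) ?_ ?_ ?_
    · intro y z hy hz
      rw [inr_mem_image_identify] at hy hz
      rcases hS with ⟨G, hG, hF, rfl⟩ | ⟨a, G, hG, hF, rfl⟩
      · simp only [Finset.mem_image, Sum.inl.injEq, exists_eq_right] at hy hz
        exact hG.2 _ hy _ hz
      · exact absurd ⟨a, Finset.mem_insert_self _ _⟩ hnew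
    · intro i y z hi hy hz
      obtain ⟨b, hb⟩ := castSucc_mem_image_identify.1 hi
      rw [inr_mem_image_identify] at hy hz
      rw [← hc.cube_cross hy hb, ← hc.cube_cross hz hb]
    · intro y hy hfull
      rw [inr_mem_image_identify] at hy
      by_contra htop
      obtain ⟨i, hi⟩ := hc.not_subset ⟨y, htop⟩
      obtain ⟨b, hb⟩ := castSucc_mem_image_identify.1 (hfull i)
      rw [hc.cube_cross hy hb] at hb
      exact hi hb

theorem mem_sigmaComplex_of_subset_image {G : Finset (Fin (d + 1) ⊕ (Fin d → Bool))}
    (hG : G.Nonempty) (hS : S ∈ (stacked (staircase d)).faces) (h : G ⊆ S.image (identify d)) :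
    G ∈ (sigmaComplex (staircase d)).faces :=
  ((sigmaComplex (staircase d)).isRelLowerSet_faces ⟨S, hS, rfl⟩).2 h hG

theorem mem_sigmaComplex_of_mem_sigmaFacets {F : Finset (Fin (d + 1) ⊕ (Fin d → Bool))}
    (hF : F ∈ sigmaFacets d) : F ∈ (sigmaComplex (staircase d)).faces := by
  have hne : F.Nonempty := Finset.card_pos.1 (by rw [card_of_mem_sigmaFacets hF]; omega)
  rcases hF with ⟨s, i, hs, rfl⟩ | ⟨π, m, n, hmn, hn, hmn', rfl⟩
  · let G : Finset (Vertex d) :=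
      insert (Sum.inr s) ((Finset.univ.erase i).image fun j => Sum.inl (j, s j))
    have hl : ∀ {j b}, Sum.inl (j, b) ∈ G ↔ j ≠ i ∧ b = s j := by
      intro j b
      simp [G, eq_comm]
    have hr : ∀ {y}, Sum.inr y ∈ G ↔ y = s := by simp [G]
    have hS : insert (Sum.inr ⟨s, hs⟩) (G.image Sum.inl) ∈ (stacked (staircase d)).faces := by
      refine Or.inr ⟨⟨s, hs⟩, G, ⟨⟨_, Finset.mem_union_left _ (Finset.mem_insert_self _ _)⟩, ?_⟩,
        fun a ha => ?_, rfl⟩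
      · have h1 : ∀ {j b}, Sum.inl (j, b) ∈ G ∪ crossFacet s → b = s j := by
          intro j b h
          rw [Finset.mem_union, hl, mem_crossFacet] at h
          exact h.elim (fun h => h.2) id
        have h2 : ∀ {y}, Sum.inr y ∈ G ∪ crossFacet s → y = s := by
          intro y h
          rw [Finset.mem_union, hr] at h
          exact h.resolve_right inr_notMem_crossFacet
        rintro (⟨j, b⟩ | y) hu (⟨k, c⟩ | z) hv
        · rintro (rfl : j = k)
          exact (h1 hu).trans (h1 hv).symm
        · obtain rfl := h2 hv
          exact (h1 hu).symm
        · obtain rfl := h2 hu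
          exact (h1 hv).symm
        · exact Or.inl (by rw [h2 hu, h2 hv])
      · exact (hl.1 (ha (mem_crossFacet.2 rfl : Sum.inl (i, a.1 i) ∈ crossFacet a.1))).1 rfl
    refine mem_sigmaComplex_of_subset_image hne hS ?_
    rintro (l | y) hx
    · induction l using Fin.lastCases with
      | last => exact last_mem_image_identify.2 ⟨_, Finset.mem_insert_self _ _⟩
      | cast j =>
        have hji : j ≠ i := by rintro rfl; exact inl_mem_stackFacet.1 hx rfl
        exact castSucc_mem_image_identify.2 ⟨s j, Finset.mem_insert_of_mem
          (Finset.mem_image_of_mem _ (hl.2 ⟨hji, rfl⟩))⟩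
    · exact inr_mem_image_identify.2 (Finset.mem_insert_of_mem
        (Finset.mem_image_of_mem _ (hr.2 (inr_mem_stackFacet.1 hx))))
  -- The signs may be read from stage `m`, since all stages from `m` to `n` agree on the chosen
  -- coordinates.
  · let G : Finset (Vertex d) :=
      ((Finset.univ.filter fun i : Fin d => (π i : ℕ) < m ∨ n ≤ (π i : ℕ)).image
        fun i => Sum.inl (i, stage π m i)) ∪ (Finset.Icc m n).image fun k => Sum.inr (stage π k)
    have hl : ∀ {j b}, Sum.inl (j, b) ∈ G ↔
        ((π j : ℕ) < m ∨ n ≤ (π j : ℕ)) ∧ b = stage π m j := by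
      intro j b
      simp [G, eq_comm]
    have hr : ∀ {y}, Sum.inr y ∈ G ↔ ∃ k, m ≤ k ∧ k ≤ n ∧ y = stage π k := by
      simp [G, and_assoc, eq_comm]
    have hlr : ∀ {j b y}, Sum.inl (j, b) ∈ G → Sum.inr y ∈ G → y j = b := by
      intro j b y h h'
      obtain ⟨h, rfl⟩ := hl.1 h
      obtain ⟨k, hmk, hkn, rfl⟩ := hr.1 h'
      rw [Bool.eq_iff_iff, stage_eq_true, stage_eq_true]
      omega
    have hS : G.image Sum.inl ∈ (stacked (staircase d)).faces := by
      refine Or.inl ⟨G, ⟨⟨_, hr.2 ⟨m, le_rfl, hmn, rfl⟩⟩, ?_⟩, fun a ha => ?_, rfl⟩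
      · rintro (⟨j, b⟩ | y) hu (⟨k, c⟩ | z) hv
        · rintro (rfl : j = k)
          exact (hl.1 hu).2.trans (hl.1 hv).2.symm
        · exact hlr hu hv
        · exact hlr hv hu
        · obtain ⟨k, -, -, rfl⟩ := hr.1 hu
          obtain ⟨l, -, -, rfl⟩ := hr.1 hv
          exact (le_total k l).imp (stage_mono π) (stage_mono π)
      -- A boundary facet inside `G` uses every label, which forces `m = d`. Its signs are then all
      -- positive, so it is not a stacked one.
      · have h1 : ∀ i, ((π i : ℕ) < m ∨ n ≤ (π i : ℕ)) ∧ a.1 i = stage π m i := fun i =>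
          hl.1 (ha (mem_crossFacet.2 rfl : Sum.inl (i, a.1 i) ∈ crossFacet a.1))
        have hmd : m = d := by
          by_contra hmd
          have hmn1 : m < n := by omega
          have := (h1 (π.symm ⟨m, by omega⟩)).1
          rw [Equiv.apply_symm_apply, Fin.val_mk] at this
          omega
        refine a.2 ((funext fun i => (h1 i).2).trans ?_)
        exact (stage_eq_top_iff (hmn.trans hn)).2 hmd
    refine mem_sigmaComplex_of_subset_image hne hS ?_
    rintro (l | y) hx
    · induction l using Fin.lastCases with
      | last => exact absurd hx last_notMem_chainFacet
      | cast j =>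
        exact castSucc_mem_image_identify.2 ⟨stage π m j,
          Finset.mem_image_of_mem _ (hl.2 ⟨inl_mem_chainFacet.1 hx, rfl⟩)⟩
    · exact inr_mem_image_identify.2 (Finset.mem_image_of_mem _ (hr.2 (inr_mem_chainFacet.1 hx)))

theorem mem_sigmaComplex_iff (G : Finset (Fin (d + 1) ⊕ (Fin d → Bool))) :
    G ∈ (sigmaComplex (staircase d)).faces ↔ G.Nonempty ∧ ∃ F ∈ sigmaFacets d, G ⊆ F := by
  constructor
  · intro hG
    refine ⟨((sigmaComplex (staircase d)).isRelLowerSet_faces hG).1, ?_⟩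
    obtain ⟨S, hS, rfl⟩ := hG
    exact exists_facet_superset_image hS
  · rintro ⟨hG, F, hF, hGF⟩
    exact ((sigmaComplex (staircase d)).isRelLowerSet_faces
      (mem_sigmaComplex_of_mem_sigmaFacets hF)).2 hGF hG

theorem sigmaComplex_hasDimension : (sigmaComplex (staircase d)).HasDimension d := by
  refine ⟨fun s hs => ?_, chainFacet 1 d d, ?_⟩
  · obtain ⟨-, F, hF, hsF⟩ := (mem_sigmaComplex_iff s).1 hs
    exact (Finset.card_le_card hsF).trans (card_of_mem_sigmaFacets hF).le
  · have := chainFacet_mem (d := d) 1 le_rfl le_rfl fun _ => rfl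
    exact ⟨mem_sigmaComplex_of_mem_sigmaFacets this, card_of_mem_sigmaFacets this⟩

theorem ncard_vertexSet_sigmaComplex (hd : 0 < d) :
    (sigmaComplex (staircase d)).vertexSet.ncard = 2 ^ d + d + 1 := by
  have huniv : (sigmaComplex (staircase d)).vertexSet = Set.univ := by
    rw [Set.eq_univ_iff_forall]
    intro v
    refine (mem_sigmaComplex_iff {v}).2 ⟨Finset.singleton_nonempty v, ?_⟩
    rcases v with l | y
    · induction l using Fin.lastCases with
      | last =>
        refine ⟨stackFacet (fun _ => false) ⟨0, hd⟩, stackFacet_mem (fun h => ?_) _,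
          Finset.singleton_subset_iff.2 last_mem_stackFacet⟩
        cases congrFun h ⟨0, hd⟩
      | cast i =>
        exact ⟨chainFacet 1 d d, chainFacet_mem 1 le_rfl le_rfl fun _ => rfl,
          Finset.singleton_subset_iff.2
            (inl_mem_chainFacet_top.2 ((1 : Equiv.Perm (Fin d)) i).2)⟩
    · refine exists_facet_superset (by simp) (fun y z hy hz => ?_) (by simp) fun _ _ h => ?_
      · rw [Finset.mem_singleton, Sum.inr.injEq] at hy hz
        exact Or.inl (hy.trans hz.symm).le
      · simpa using h ⟨0, hd⟩
  rw [huniv, Set.ncard_univ]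
  simp
  ring

/-- A `stackFacet` misses the label `i`, and a chain facet with `m < n` misses the coordinate at
position `m`. Only `m = n = d` remains, where the permutation plays no role. -/
theorem baseFace_subset_iff {F : Finset (Fin (d + 1) ⊕ (Fin d → Bool))} (hF : F ∈ sigmaFacets d) :
    baseFace d ⊆ F ↔ F = chainFacet 1 d d := by
  have hmem : ∀ i : Fin d, Sum.inl i.castSucc ∈ baseFace d := fun i =>
    Finset.mem_image_of_mem _ (Finset.mem_univ i)
  constructor
  · intro h
    rcases hF with ⟨s, i, hs, rfl⟩ | ⟨π, m, n, hmn, hn, hmn', rfl⟩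
    · exact absurd rfl (inl_mem_stackFacet.1 (h (hmem i)))
    · have hmd : m = d := by
        by_contra hmd
        have hmn1 : m < n := by omega
        have := inl_mem_chainFacet.1 (h (hmem (π.symm ⟨m, by omega⟩)))
        rw [Equiv.apply_symm_apply, Fin.val_mk] at this
        omega
      obtain rfl : n = d := by omega
      subst hmd
      refine chainFacet_congr le_rfl fun k hk hk' => ?_
      obtain rfl : k = m := by omega
      rw [(stage_eq_top_iff le_rfl).2 rfl, (stage_eq_top_iff le_rfl).2 rfl]
  · rintro rfl x hx
    obtain ⟨i, -, rfl⟩ := Finset.mem_image.1 hx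
    exact inl_mem_chainFacet_top.2 ((1 : Equiv.Perm (Fin d)) i).2

theorem card_baseFace : (baseFace d).card = d := by
  have hinj : Function.Injective fun i : Fin d =>
      (Sum.inl i.castSucc : Fin (d + 1) ⊕ (Fin d → Bool)) :=
    Sum.inl_injective.comp (Fin.castSucc_injective d)
  rw [baseFace, Finset.card_image_of_injective _ hinj, Finset.card_univ, Fintype.card_fin]

theorem isFreeFace_baseFace (hd : 0 < d) : (sigmaComplex (staircase d)).IsFreeFace (baseFace d) := by
  have hF : chainFacet 1 d d ∈ sigmaFacets d := chainFacet_mem 1 le_rfl le_rfl fun _ => rfl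
  have hsub := (baseFace_subset_iff hF).2 rfl
  refine ⟨(mem_sigmaComplex_iff _).2 ⟨Finset.card_pos.1 (by rwa [card_baseFace]), _, hF, hsub⟩,
    chainFacet 1 d d, ⟨mem_sigmaComplex_of_mem_sigmaFacets hF, ?_⟩, ?_⟩
  · refine lt_of_le_of_ne hsub fun h => ?_
    have := congrArg Finset.card h
    rw [card_baseFace, card_of_mem_sigmaFacets hF] at this
    omega
  · rintro t ⟨ht, hbt⟩
    obtain ⟨-, F, hF', htF⟩ := (mem_sigmaComplex_iff t).1 ht
    obtain rfl := (baseFace_subset_iff hF').1 (hbt.1.trans htF)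
    refine Finset.eq_of_subset_of_card_le htF ?_
    have := Finset.card_lt_card hbt
    rw [card_baseFace] at this
    rw [card_of_mem_sigmaFacets hF']
    exact this

theorem existsUnique_isFreeFace (hd : 2 ≤ d) : ∃! s, (sigmaComplex (staircase d)).IsFreeFace s :=
  ⟨baseFace d, isFreeFace_baseFace (by omega), fun _ hs =>
    PreAbstractSimplicialComplex.eq_of_isFreeFace_of_generated (Nat.succ_pos d)
      (fun _ => card_of_mem_sigmaFacets) mem_sigmaComplex_iff
      (fun _ hF _ hv hne => exists_ne_facet_of_ridge hd hF hv hne) hs⟩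

theorem sigmaComplex_isShellable_and_isCollapsible :
    (sigmaComplex (staircase d)).IsShellable ∧ (sigmaComplex (staircase d)).IsCollapsible :=
  PreAbstractSimplicialComplex.isShellable_and_isCollapsible_of_key (sigmaFacets d)
    (Set.toFinite _) ⟨_, chainFacet_mem 1 le_rfl le_rfl fun _ => rfl⟩ (Nat.succ_pos d)
    (fun _ => card_of_mem_sigmaFacets) mem_sigmaComplex_iff key
    (fun _ hF _ hF' hne hkey => exists_earlier_ridge hF hF' hne hkey) fun _ => exists_new_ridge

end

end Antiprism

theorem theorem2p2 (d : ℕ) (hd : 2 ≤ d) :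
    ∃ T : PreAbstractSimplicialComplex (Antiprism.Vertex d),
      Antiprism.IsRegularAntiprismTriangulation T ∧
      Antiprism.IdentifiesOnlyStackedFacets T ∧
      (Antiprism.sigmaComplex T).HasDimension d ∧
      (Antiprism.sigmaComplex T).vertexSet.ncard = 2 ^ d + d + 1 ∧
      (Antiprism.sigmaComplex T).IsShellable ∧
      (Antiprism.sigmaComplex T).IsCollapsible ∧
      ∃! s, (Antiprism.sigmaComplex T).IsFreeFace s :=
  ⟨Antiprism.staircase d, Antiprism.staircase_isRegularAntiprismTriangulation (by omega),
    Antiprism.staircase_identifiesOnlyStackedFacets, Antiprism.sigmaComplex_hasDimension,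
    Antiprism.ncard_vertexSet_sigmaComplex (by omega),
    Antiprism.sigmaComplex_isShellable_and_isCollapsible.1,
    Antiprism.sigmaComplex_isShellable_and_isCollapsible.2, Antiprism.existsUnique_isFreeFace hd⟩
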